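/- For an entire function $f$ write $M(r)=M(r,f)=\max_{|z|=r}|f(z)|$, and let $f^n$ and $M^n$ denote $n$-th iterates. For a transcendental entire function $f$ and $R>0$ with $M(r)>r$ for all $r\ge R$, put $A_R(f)=\{z\in\mathbb C: |f^n(z)|\ge M^n(R) \text{ for all } n\ge 0\}$; the fast escaping set is $A(f)=\bigcup_{\ell\ge 0} f^{-\ell}(A_R(f))$, which does not depend on the choice of such an $R$. A set $E\subset\mathbb C$ is a spider's web if it is connected and there are bounded simply connected domains $G_1\subset G_2\subset\cdots$ with $\partial G_n\subset E$ for all $n$ and $\bigcup_n G_n=\mathbb C$. **Theorem.** (a) There exist transcendental entire functions of the form $$f(z)=z^3\prod_{n=1}^\infty\Bigl(1+\frac z{a_n}\Bigr)^{2p_n},$$ where the $p_n$ are positive integers and $(a_n)$ is positive and strictly increasing, such that $A(f)\cap(-\infty,0]=\emptyset$; in particular, $A(f)$ is not a spider's web. (b) Moreover, let $(\delta_n)_{n\ge1}$ be a positive sequence with $\sum_n\delta_n=\infty$, and put $d_n=\min(\delta_n,1/2)$ (so $d_n=\delta_n$ if $\delta_n\le 1/2$). Then there are a function $f$ as in (a)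 with $$p_n=\bigl[a_n^{d_n/4}/4\bigr]\quad(n\ge1),$$ and a value $R>1$ with $M(r)>r$ for all $r\ge R$, such that, with $R_n=M^n(R)$ and $$\varepsilon_n=\max_{R_n\le r\le R_{n+1}}\frac{\log\log M(r)}{\log r},$$ there is a strictly increasing sequence $(n_k)_{k\ge1}$ of positive integers such that $$\varepsilon_{n_k}\le d_k+\frac1{2^{n_k}}\quad\text{for all } k\ge1,$$ $$\varepsilon_{n_k+m}\le\frac{d_k}{3^{m-1}}+\frac1{2^{n_k+m}}\quad\text{for all } k\ge1,\ 1\le m<n_{k+1}-n_k.$$ -/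

import Mathlib

noncomputable section

namespace FastEscaping

/-- A transcendental entire function: entire and not a polynomial. -/
def IsTranscendentalEntire (f : ℂ → ℂ) : Prop :=
  Differentiable ℂ f ∧ ¬ ∃ P : Polynomial ℂ, ∀ z, f z = P.eval z

/-- The maximum modulus `M(r) = max_{|z| = r} |f z|`; for continuous `f` and `r ≥ 0` the supremum
is attained. -/
def maxModulus (f : ℂ → ℂ) (r : ℝ) : ℝ :=
  sSup ((fun z => ‖f z‖) '' Metric.sphere (0 : ℂ) r)

/-- The condition on `R` in the definition of the fast escaping set: `R > 0` and `M(r) > r` for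
all `r ≥ R`. -/
def IsAdmissible (f : ℂ → ℂ) (R : ℝ) : Prop :=
  0 < R ∧ ∀ r, R ≤ r → r < maxModulus f r

/-- The `n`-th iterate `M^n(R)` of the maximum modulus function, started at `R`. -/
def maxModulusIter (f : ℂ → ℂ) (R : ℝ) (n : ℕ) : ℝ :=
  (maxModulus f)^[n] R

/-- The set `A_R(f) = {z : |f^n(z)| ≥ M^n(R) for all n}`. -/
def fastEscapingLevel (f : ℂ → ℂ) (R : ℝ) : Set ℂ :=
  {z | ∀ n : ℕ, maxModulusIter f R n ≤ ‖f^[n] z‖}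

/-- The fast escaping set `A(f) = ⋃ ℓ, f^{-ℓ}(A_R(f))`, where `R` is admissible (the set does not
depend on which admissible `R` is used). -/
def fastEscapingSet (f : ℂ → ℂ) (R : ℝ) : Set ℂ :=
  ⋃ l : ℕ, f^[l] ⁻¹' fastEscapingLevel f R

/-- A set `E` is a spider's web if it is connected and there are bounded simply connected domains
`G 0 ⊆ G 1 ⊆ ⋯` with union `ℂ` and boundaries contained in `E`. -/
def IsSpidersWeb (E : Set ℂ) : Prop :=
  IsConnected E ∧ ∃ G : ℕ → Set ℂ,
    (∀ n, IsOpen (G n) ∧ IsSimplyConnected (G n) ∧ Bornology.IsBounded (G n)) ∧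
    (∀ n, frontier (G n) ⊆ E) ∧ (∀ n, G n ⊆ G (n + 1)) ∧ ⋃ n, G n = Set.univ

/-- `f z = z ^ 3 * ∏ n, (1 + z / a n) ^ (2 * p n)` with a convergent product at every `z`.
(Sequences are indexed from `0`: `a 0` is the first zero modulus.) -/
def HasProductForm (f : ℂ → ℂ) (a : ℕ → ℝ) (p : ℕ → ℕ) : Prop :=
  ∀ z : ℂ, Multipliable (fun n => (1 + z / (a n : ℂ)) ^ (2 * p n)) ∧
    f z = z ^ 3 * ∏' n, (1 + z / (a n : ℂ)) ^ (2 * p n)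

/-- `f` is a transcendental entire function of the form
`f z = z ^ 3 * ∏ n, (1 + z / a n) ^ (2 * p n)` with positive integers `p n` and `a` positive and
strictly increasing; `A(f)` does not meet the closed negative real axis, and `A(f)` is not a
spider's web. -/
def IsExample (f : ℂ → ℂ) (a : ℕ → ℝ) (p : ℕ → ℕ) : Prop :=
  IsTranscendentalEntire f ∧ (∀ n, 0 < a n) ∧ StrictMono a ∧ (∀ n, 1 ≤ p n) ∧
    HasProductForm f a p ∧
    ∀ R, IsAdmissible f R →
      fastEscapingSet f R ∩ ((fun x : ℝ => (x : ℂ)) '' Set.Iic 0) = ∅ ∧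
      ¬ IsSpidersWeb (fastEscapingSet f R)

/-- `ε = max_{R_n ≤ r ≤ R_{n+1}} log log M(r) / log r`, with `R_n = M^n(R)`; the maximum is
attained. -/
def IsGrowthExponent (f : ℂ → ℂ) (R : ℝ) (n : ℕ) (ε : ℝ) : Prop :=
  IsGreatest ((fun r => Real.log (Real.log (maxModulus f r)) / Real.log r) ''
    Set.Icc (maxModulusIter f R n) (maxModulusIter f R (n + 1))) ε

end FastEscaping

end

namespace FastEscaping

open Filter Topology

/-! On the scale t = log r put ψ(t) = log M(e^t). All zeros are nonpositive, so M(r) = f(r); and if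
the zeros -exp(X_k) are sparse, ψ is within 1 of an affine map D t - C for 2X_{k-1} ≤ t ≤ X_k/2
(`logGrowth_le_affine`, `sub_le_logGrowth`). The multiplicities 2p_k are even, so f maps the
nonpositive axis into itself. There the zero -exp(X_k), of order about exp(d_k X_k/4)/2, makes f
small nearby: on [-exp(X_k), 0] the bound for log|f| is D(1 - d_k/8)X_k - C + 1, not about D X_k - C
(`norm_neg_le_of_le_zero`). Each zero costs a negative orbit a relative factor 1 - d_k/8 against
orbits of M.

The next zero is put exactly where the affine recursion bounds the negative orbits after m more
steps, m large (`Stage.Invariant.exists_step`), so the loss recurs at every stage. Let W be a lower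
bound for a reference orbit of ψ when the negative orbit is below X. While X/W stays at least 1/2 it
is multiplied by at most 1 - d_k/32 per stage, apart from a possible first stage; as ∑ d_k = ∞, it
must fall below 1/2 (`exists_event`). Then the reference point may be replaced by its predecessor, a
gain of one iteration. Repetition makes every negative orbit lag behind M^n(R) by any number of
iterations (`IsNegOrbit.exists_lag`), so it is not fast escaping. A set missing an unbounded
connected set through 0 is no spider's web.

For the growth, the degree after the k-th zero is at most exp(d_k X_k/4), whence log ψ(t) ≤ d_k
X_k/4 + log(6t) up to X_{k+1}/2 (`log_psi_le`). Taking R_{n_k} ≤ exp(X_k/2) < R_{n_k+1}, the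
inequality ψ(t) ≥ 3t yields the decay 3^{-(m-1)}. -/

theorem norm_one_add_pow_sub_one_le (w : ℂ) (N : ℕ) :
    ‖(1 + w) ^ N - 1‖ ≤ Real.exp (N * ‖w‖) - 1 := by
  simpa using Finset.norm_prod_one_add_sub_one_le (Finset.range N) (fun _ => w)

theorem summable_exp_sub_one {u : ℕ → ℝ} (hu : Summable u) :
    Summable (fun n => Real.exp (u n) - 1) := by
  refine Summable.of_norm_bounded_eventually (g := fun n => 2 * |u n|) (hu.abs.mul_left 2) ?_
  have h1 : ∀ᶠ n in cofinite, |u n| < 1 := by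
    have := hu.abs.tendsto_cofinite_zero
    exact this.eventually (gt_mem_nhds one_pos)
  filter_upwards [h1] with n hn
  exact Real.abs_exp_sub_one_le hn.le

/-! ### The canonical product and its maximum modulus -/

/-- The canonical product `z ^ 3 * ∏ n, (1 + z / a n) ^ (2 * p n)`. -/
noncomputable def canonicalProd (a : ℕ → ℝ) (p : ℕ → ℕ) (z : ℂ) : ℂ :=
  z ^ 3 * ∏' n, (1 + z / (a n : ℂ)) ^ (2 * p n)

section

variable {a : ℕ → ℝ} {p : ℕ → ℕ}

theorem factor_bound (ha : ∀ n, 0 < a n) {r : ℝ} {z : ℂ} (hz : ‖z‖ ≤ r) (n : ℕ) :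
    ‖(1 + z / (a n : ℂ)) ^ (2 * p n) - 1‖ ≤ Real.exp (2 * r * (p n / a n)) - 1 := by
  refine (norm_one_add_pow_sub_one_le _ _).trans ?_
  have := ha n
  rw [norm_div, Complex.norm_real, Real.norm_of_nonneg this.le]
  have h1 : ((2 * p n : ℕ) : ℝ) * (‖z‖ / a n) ≤ 2 * r * (p n / a n) :=
    calc ((2 * p n : ℕ) : ℝ) * (‖z‖ / a n) = 2 * ‖z‖ * (p n / a n) := by push_cast; ring
      _ ≤ _ := by gcongr
  gcongr

theorem multipliable_factors (ha : ∀ n, 0 < a n) (hs : Summable fun n => (p n : ℝ) / a n)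
    (z : ℂ) : Multipliable (fun n => (1 + z / (a n : ℂ)) ^ (2 * p n)) := by
  have := multipliable_one_add_of_summable
    (f := fun n => (1 + z / (a n : ℂ)) ^ (2 * p n) - 1)
    (Summable.of_nonneg_of_le (fun _ => norm_nonneg _) (factor_bound ha le_rfl)
      (summable_exp_sub_one (hs.mul_left (2 * ‖z‖))))
  simpa using this

theorem differentiable_canonicalProd (ha : ∀ n, 0 < a n)
    (hs : Summable fun n => (p n : ℝ) / a n) : Differentiable ℂ (canonicalProd a p) := by
  have key : ∀ r : ℝ, DifferentiableOn ℂ (fun z => ∏' n, (1 + z / (a n : ℂ)) ^ (2 * p n))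
      (Metric.ball 0 r) := by
    intro r
    have h := Summable.hasProdLocallyUniformlyOn_nat_one_add
      (f := fun n (z : ℂ) => (1 + z / (a n : ℂ)) ^ (2 * p n) - 1)
      (K := Metric.ball (0 : ℂ) r) Metric.isOpen_ball
      (summable_exp_sub_one (hs.mul_left (2 * r)))
      (.of_forall fun n x hx => factor_bound ha (by simpa using (Metric.mem_ball.1 hx).le) n)
      (fun n => by fun_prop)
    simp only [add_sub_cancel] at h
    exact h.differentiableOn (.of_forall fun _ ↦ by
      simpa [Finset.prod_fn] using DifferentiableOn.finsetProd (fun _ _ ↦ by fun_prop))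
      Metric.isOpen_ball
  intro z
  refine (differentiableAt_pow _).mul ?_
  exact (key (‖z‖ + 1)).differentiableAt (Metric.isOpen_ball.mem_nhds (by simp))

theorem norm_canonicalProd_le (ha : ∀ n, 0 < a n) (hs : Summable fun n => (p n : ℝ) / a n)
    {z : ℂ} {g : ℕ → ℝ} (hg : Summable g)
    (h : ∀ n, ‖1 + z / (a n : ℂ)‖ ^ (2 * p n) ≤ Real.exp (g n)) :
    ‖canonicalProd a p z‖ ≤ ‖z‖ ^ 3 * Real.exp (∑' n, g n) := by
  rw [canonicalProd, norm_mul, norm_pow, (multipliable_factors ha hs z).norm_tprod]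
  refine mul_le_mul_of_nonneg_left ?_ (by positivity)
  refine le_of_tendsto_of_tendsto' (multipliable_factors ha hs z).norm.hasProd
    ((Real.continuous_exp.tendsto _).comp hg.hasSum) fun s => ?_
  simp only [Function.comp, Real.exp_sum]
  refine Finset.prod_le_prod (fun _ _ => norm_nonneg _) fun n _ => ?_
  rw [norm_pow]
  exact h n

/-- `∑ 2 pₙ log (1 + r / aₙ)`, the logarithm of the product at a nonnegative `r`. -/
noncomputable def logFactors (a : ℕ → ℝ) (p : ℕ → ℕ) (r : ℝ) : ℝ :=
  ∑' n, 2 * p n * Real.log (1 + r / a n)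

theorem logFactor_le (ha : ∀ n, 0 < a n) {r : ℝ} (hr : 0 ≤ r) (n : ℕ) :
    2 * p n * Real.log (1 + r / a n) ≤ 2 * r * (p n / a n) := by
  have h : 0 ≤ r / a n := div_nonneg hr (ha n).le
  have := Real.log_le_sub_one_of_pos (show 0 < 1 + r / a n by linarith)
  calc 2 * p n * Real.log (1 + r / a n) ≤ 2 * p n * (r / a n) := by gcongr; linarith
    _ = _ := by ring

theorem logFactor_nonneg (ha : ∀ n, 0 < a n) {r : ℝ} (hr : 0 ≤ r) (n : ℕ) :
    0 ≤ 2 * p n * Real.log (1 + r / a n) := by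
  have h : 0 ≤ r / a n := div_nonneg hr (ha n).le
  have := Real.log_nonneg (show 1 ≤ 1 + r / a n by linarith)
  positivity

theorem summable_logFactors (ha : ∀ n, 0 < a n) (hs : Summable fun n => (p n : ℝ) / a n)
    {r : ℝ} (hr : 0 ≤ r) : Summable fun n => 2 * p n * Real.log (1 + r / a n) :=
  Summable.of_nonneg_of_le (logFactor_nonneg ha hr) (logFactor_le ha hr) (hs.mul_left _)

theorem exp_logFactor (ha : ∀ n, 0 < a n) {r : ℝ} (hr : 0 ≤ r) (n : ℕ) :
    Real.exp (2 * p n * Real.log (1 + r / a n)) = (1 + r / a n) ^ (2 * p n) := by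
  have h : 0 ≤ r / a n := div_nonneg hr (ha n).le
  have := Real.exp_nat_mul (Real.log (1 + r / a n)) (2 * p n)
  push_cast at this
  rw [this, Real.exp_log (by linarith)]

theorem norm_canonicalProd_le_logFactors (ha : ∀ n, 0 < a n)
    (hs : Summable fun n => (p n : ℝ) / a n) (z : ℂ) :
    ‖canonicalProd a p z‖ ≤ ‖z‖ ^ 3 * Real.exp (logFactors a p ‖z‖) := by
  refine norm_canonicalProd_le ha hs (summable_logFactors ha hs (norm_nonneg z)) fun n => ?_
  rw [exp_logFactor ha (norm_nonneg z)]
  refine pow_le_pow_left₀ (norm_nonneg _) ((norm_add_le _ _).trans ?_) _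
  rw [norm_div, Complex.norm_real, Real.norm_of_nonneg (ha n).le, norm_one]

theorem norm_canonicalProd_ofReal (ha : ∀ n, 0 < a n)
    (hs : Summable fun n => (p n : ℝ) / a n) {r : ℝ} (hr : 0 ≤ r) :
    ‖canonicalProd a p r‖ = r ^ 3 * Real.exp (logFactors a p r) := by
  rw [canonicalProd, norm_mul, norm_pow, (multipliable_factors ha hs _).norm_tprod,
    Complex.norm_real, Real.norm_of_nonneg hr]
  congr 1
  have h1 : HasProd (fun n => (1 + r / a n) ^ (2 * p n)) (Real.exp (logFactors a p r)) := by
    have := (summable_logFactors ha hs hr).hasSum.rexp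
    simpa only [Function.comp_def, exp_logFactor ha hr] using! this
  rw [← h1.tprod_eq]
  congr 1
  ext n
  have h : 0 ≤ r / a n := div_nonneg hr (ha n).le
  rw [norm_pow, show (1 + (r : ℂ) / (a n : ℂ)) = ((1 + r / a n : ℝ) : ℂ) by push_cast; ring,
    Complex.norm_real, Real.norm_of_nonneg (by linarith)]

theorem maxModulus_canonicalProd (ha : ∀ n, 0 < a n)
    (hs : Summable fun n => (p n : ℝ) / a n) {r : ℝ} (hr : 0 ≤ r) :
    maxModulus (canonicalProd a p) r = r ^ 3 * Real.exp (logFactors a p r) := by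
  refine IsGreatest.csSup_eq ⟨⟨(r : ℂ), by simp [hr], norm_canonicalProd_ofReal ha hs hr⟩, ?_⟩
  rintro _ ⟨z, hz, rfl⟩
  have hz : ‖z‖ = r := by simpa using hz
  rw [← hz]
  exact norm_canonicalProd_le_logFactors ha hs z

/-- A polynomial with the infinitely many roots -a_n vanishes, but the product is positive at 1. -/
theorem isTranscendentalEntire_canonicalProd (ha : ∀ n, 0 < a n) (hm : StrictMono a)
    (hs : Summable fun n => (p n : ℝ) / a n) (hp : ∀ n, 1 ≤ p n) :
    IsTranscendentalEntire (canonicalProd a p) := by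
  refine ⟨differentiable_canonicalProd ha hs, ?_⟩
  rintro ⟨P, hP⟩
  have hz : ∀ n, P.IsRoot (-(a n : ℂ)) := by
    intro n
    rw [Polynomial.IsRoot, ← hP, canonicalProd]
    have hne : (a n : ℂ) ≠ 0 := by exact_mod_cast (ha n).ne'
    rw [tprod_of_exists_eq_zero ⟨n, ?_⟩, mul_zero]
    rw [neg_div, div_self hne, add_neg_cancel]
    exact zero_pow (by have := hp n; omega)
  have hinj : Function.Injective fun n => -(a n : ℂ) := fun m n h => hm.injective (by simpa using h)
  have h0 : P = 0 := Polynomial.eq_zero_of_infinite_isRoot P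
    ((Set.infinite_range_of_injective hinj).mono (by rintro _ ⟨n, rfl⟩; exact hz n))
  have h1 := norm_canonicalProd_ofReal ha hs (r := 1) zero_le_one
  rw [hP, h0] at h1
  simp only [Polynomial.eval_zero, norm_zero, one_pow, one_mul] at h1
  exact (Real.exp_pos _).ne h1

/-- Even exponents make the infinite product nonnegative at real points, and the cube carries the
sign. -/
theorem canonicalProd_neg_real (ha : ∀ n, 0 < a n) (hs : Summable fun n => (p n : ℝ) / a n)
    {x : ℝ} (hx : 0 ≤ x) : ∃ y : ℝ, 0 ≤ y ∧ canonicalProd a p (-x : ℝ) = ((-y : ℝ) : ℂ) := by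
  have hm : Multipliable fun n => (1 + -x / a n) ^ (2 * p n) := by
    have := multipliable_one_add_of_summable
      (f := fun n => (1 + -x / a n) ^ (2 * p n) - 1)
      (Summable.of_nonneg_of_le (fun _ => norm_nonneg _) (fun n => ?_)
      (summable_exp_sub_one (hs.mul_left (2 * x))))
    · simpa using this
    · have := factor_bound (p := p) (z := ((-x : ℝ) : ℂ)) (r := x) ha (by simp [abs_of_nonneg hx]) n
      rw [← Complex.norm_real]
      push_cast at this ⊢
      exact this
  have hc : HasProd (fun n => (1 + ((-x : ℝ) : ℂ) / (a n : ℂ)) ^ (2 * p n))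
      ((∏' n, (1 + -x / a n) ^ (2 * p n) : ℝ) : ℂ) := by
    have := hm.hasProd.map Complex.ofRealHom Complex.continuous_ofReal
    simpa [Function.comp_def] using this
  refine ⟨x ^ 3 * ∏' n, (1 + -x / a n) ^ (2 * p n), mul_nonneg (by positivity) ?_, ?_⟩
  · refine ge_of_tendsto' hm.hasProd fun s => Finset.prod_nonneg fun n _ => ?_
    rw [pow_mul]
    positivity
  · rw [canonicalProd, hc.tprod_eq]
    push_cast
    ring

end

/-! ### Well separated zeros: affine bounds for log M -/

/-- Growth conditions on the logarithms `X k` of the moduli of the zeros and on half the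
multiplicities `p k` that make the zeros well separated. -/
structure WellSeparated (X : ℕ → ℝ) (p : ℕ → ℕ) : Prop where
  lower : ∀ k : ℕ, 2 * ((k : ℝ) + 1) ≤ X k
  ratio : ∀ k, 4 * X k ≤ X (k + 1)
  mult_le : ∀ k, 4 * (p k : ℝ) ≤ Real.exp (X k / 8)
  mult_pos : ∀ k, 1 ≤ p k

/-- The degree of the product of the first `k` factors. -/
noncomputable def partialDegree (p : ℕ → ℕ) (k : ℕ) : ℝ :=
  3 + ∑ m ∈ Finset.range k, 2 * (p m : ℝ)

/-- Minus the logarithm of the leading coefficient of the product of the first `k` factors. -/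
noncomputable def partialOffset (X : ℕ → ℝ) (p : ℕ → ℕ) (k : ℕ) : ℝ :=
  ∑ m ∈ Finset.range k, 2 * (p m : ℝ) * X m

/-- `ψ t = log M (exp t)` for the canonical product with zeros `-exp (X m)`. -/
noncomputable def logGrowth (X : ℕ → ℝ) (p : ℕ → ℕ) (t : ℝ) : ℝ :=
  3 * t + logFactors (fun n => Real.exp (X n)) p (Real.exp t)

section

variable {X : ℕ → ℝ} {p : ℕ → ℕ}

/-- Sorts the factors into those left behind, one exceptional factor `k`, and errors whose geometric
sum is the constant 1 of all later bounds. -/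
theorem tsum_le_of_le_tail {g L : ℕ → ℝ} {k : ℕ} {G : ℝ} (hg : Summable g)
    (h : ∀ m, g m ≤ (if m < k then L m else 0) + (if m = k then G else 0) + 1 / 2 / 2 ^ m) :
    ∑' m, g m ≤ ∑ m ∈ Finset.range k, L m + G + 1 := by
  have h1 : HasSum (fun m => if m < k then L m else 0) (∑ m ∈ Finset.range k, L m) := by
    have := hasSum_sum_of_ne_finset_zero (f := fun m => if m < k then L m else 0)
      (L := SummationFilter.unconditional ℕ) (s := Finset.range k) (fun m hm => by simp at hm; simp [hm])
    convert! this using 1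
    refine Finset.sum_congr rfl fun m hm => ?_
    simp at hm
    simp [hm]
  have h2 : HasSum (fun m => if m = k then G else 0) G := hasSum_ite_eq k G
  have h3 : HasSum (fun m : ℕ => (1 : ℝ) / 2 / 2 ^ m) 1 := hasSum_geometric_two' 1
  have h4 := (h1.add h2).add h3
  rw [← h4.tsum_eq]
  exact hg.tsum_le_tsum h h4.summable

namespace WellSeparated

theorem pos (hX : WellSeparated X p) (k : ℕ) : 0 < X k := by
  have := hX.lower k
  have : (0 : ℝ) ≤ k := k.cast_nonneg
  linarith

theorem strictMono (hX : WellSeparated X p) : StrictMono X :=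
  strictMono_nat_of_lt_succ fun k => by linarith [hX.ratio k, hX.pos k]

theorem four_mul_le (hX : WellSeparated X p) {m k : ℕ} (h : m < k) : 4 * X m ≤ X k :=
  (hX.ratio m).trans (hX.strictMono.monotone h)

theorem exp_decay (hX : WellSeparated X p) (m : ℕ) : 2 * (p m : ℝ) * Real.exp (-(X m / 2)) ≤ 1 / 2 / 2 ^ m := by
  have h1 : Real.exp (-(X m / 2)) * Real.exp (X m / 8) ≤ (1 / 2) ^ (m + 1) := by
    have h2 : (2 : ℝ) ≤ Real.exp (3 / 4) := by
      have := Real.quadratic_le_exp_of_nonneg (x := 3 / 4) (by norm_num)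
      linarith
    have h3 : Real.exp (-(3 / 4)) ≤ 1 / 2 := by
      rw [Real.exp_neg, ← one_div]
      exact one_div_le_one_div_of_le two_pos h2
    calc Real.exp (-(X m / 2)) * Real.exp (X m / 8) ≤ Real.exp ((m + 1 : ℕ) * (-(3 / 4))) := by
          rw [← Real.exp_add]
          have := hX.lower m
          gcongr
          push_cast
          linarith
      _ = Real.exp (-(3 / 4)) ^ (m + 1) := Real.exp_nat_mul _ _
      _ ≤ _ := by gcongr
  have h4 := hX.mult_le m
  have h5 : (1 / 2 : ℝ) ^ (m + 1) ≤ 1 / 2 ^ m := by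
    rw [one_div_pow]
    gcongr
    · norm_num
    · omega
  calc 2 * (p m : ℝ) * Real.exp (-(X m / 2))
      = 1 / 2 * (Real.exp (-(X m / 2)) * (4 * p m)) := by ring
    _ ≤ 1 / 2 * (Real.exp (-(X m / 2)) * Real.exp (X m / 8)) := by gcongr
    _ ≤ 1 / 2 * (1 / 2 ^ m) := by gcongr; exact h1.trans h5
    _ = _ := by ring

theorem summable_div (hX : WellSeparated X p) : Summable fun n => (p n : ℝ) / Real.exp (X n) := by
  refine Summable.of_nonneg_of_le (fun n => by positivity) (fun n => ?_) (summable_geometric_two' 1)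
  have h1 := hX.exp_decay n
  have h2 : Real.exp (-X n) ≤ Real.exp (-(X n / 2)) := by
    have := hX.pos n
    gcongr
    linarith
  calc (p n : ℝ) / Real.exp (X n) = p n * Real.exp (-X n) := by rw [Real.exp_neg]; rfl
    _ ≤ p n * Real.exp (-(X n / 2)) := by gcongr
    _ ≤ 2 * p n * Real.exp (-(X n / 2)) := by
        have : (0 : ℝ) ≤ p n * Real.exp (-(X n / 2)) := by positivity
        linarith
    _ ≤ _ := h1

theorem logTerm_eq (t : ℝ) (m : ℕ) :
    Real.log (1 + Real.exp t / Real.exp (X m)) = Real.log (1 + Real.exp (t - X m)) := by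
  rw [Real.exp_sub]

theorem logTerm_le_of_le_half (hX : WellSeparated X p) {t : ℝ} {m : ℕ} (ht : t ≤ X m / 2) :
    2 * (p m : ℝ) * Real.log (1 + Real.exp t / Real.exp (X m)) ≤ 1 / 2 / 2 ^ m := by
  refine le_trans ?_ (hX.exp_decay m)
  gcongr
  rw [logTerm_eq]
  have h1 := Real.log_le_sub_one_of_pos (show 0 < 1 + Real.exp (t - X m) by positivity)
  have h2 : Real.exp (t - X m) ≤ Real.exp (-(X m / 2)) := by gcongr; linarith
  linarith

/-- Factor e^(t - X) out of 1 + e^(t - X): the remaining logarithm is at most e^(X - t) ≤ e^(-X/2),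
which `exp_decay` absorbs. -/
theorem logTerm_le_of_two_mul_le (hX : WellSeparated X p) {t : ℝ} {m : ℕ} (ht : 2 * X m ≤ t) :
    2 * (p m : ℝ) * Real.log (1 + Real.exp t / Real.exp (X m))
      ≤ 2 * p m * (t - X m) + 1 / 2 / 2 ^ m := by
  have h0 := hX.pos m
  have h1 : Real.log (1 + Real.exp (t - X m)) ≤ (t - X m) + Real.exp (-(X m / 2)) := by
    have e : 1 + Real.exp (t - X m) = Real.exp (t - X m) * (1 + Real.exp (-(t - X m))) := by
      rw [mul_add, ← Real.exp_add]
      simp [add_comm]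
    rw [e, Real.log_mul (Real.exp_pos _).ne' (by positivity), Real.log_exp]
    have h1 := Real.log_le_sub_one_of_pos (show 0 < 1 + Real.exp (-(t - X m)) by positivity)
    have h2 : Real.exp (-(t - X m)) ≤ Real.exp (-(X m / 2)) := by gcongr; linarith
    linarith
  rw [logTerm_eq]
  have h2 := hX.exp_decay m
  have h3 := mul_le_mul_of_nonneg_left h1 (show 0 ≤ 2 * (p m : ℝ) by positivity)
  linarith

theorem le_logTerm (t : ℝ) (m : ℕ) :
    t - X m ≤ Real.log (1 + Real.exp t / Real.exp (X m)) := by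
  rw [logTerm_eq, Real.le_log_iff_exp_le (by positivity)]
  linarith

theorem logTerm_le_self (hX : WellSeparated X p) {t : ℝ} {m : ℕ} (ht : 1 ≤ t) :
    Real.log (1 + Real.exp t / Real.exp (X m)) ≤ t := by
  rw [Real.log_le_iff_le_exp (by positivity)]
  have h1 : Real.exp t / Real.exp (X m) ≤ Real.exp t / 2 := by
    have h2 := Real.add_one_le_exp (X m)
    have := hX.lower m
    have : (0 : ℝ) ≤ m := m.cast_nonneg
    gcongr
    linarith
  have := Real.add_one_le_exp t
  linarith

theorem summable_logTerm (hX : WellSeparated X p) (t : ℝ) :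
    Summable fun m => 2 * (p m : ℝ) * Real.log (1 + Real.exp t / Real.exp (X m)) :=
  summable_logFactors (fun n => Real.exp_pos (X n)) hX.summable_div (Real.exp_pos t).le

theorem logTerm_nonneg (t : ℝ) (m : ℕ) :
    0 ≤ 2 * (p m : ℝ) * Real.log (1 + Real.exp t / Real.exp (X m)) :=
  logFactor_nonneg (fun n => Real.exp_pos (X n)) (Real.exp_pos t).le m

theorem exp_logGrowth (hX : WellSeparated X p) (t : ℝ) :
    maxModulus (canonicalProd (fun n => Real.exp (X n)) p) (Real.exp t)
      = Real.exp (logGrowth X p t) := by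
  rw [maxModulus_canonicalProd (fun n => Real.exp_pos (X n)) hX.summable_div (Real.exp_pos t).le,
    logGrowth, Real.exp_add, ← Real.exp_nat_mul]
  norm_num

theorem logGrowth_mono (hX : WellSeparated X p) : Monotone (logGrowth X p) := by
  intro s t hst
  unfold logGrowth logFactors
  have := (hX.summable_logTerm s).tsum_le_tsum (fun m => ?_) (hX.summable_logTerm t)
  · linarith
  · gcongr

/-- Drop the factors from `k` on and replace log(1 + x) by log x. No range of `t` is prescribed, so
lower bounds for orbits can be iterated freely. -/
theorem sub_le_logGrowth (hX : WellSeparated X p) (k : ℕ) (t : ℝ) :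
    partialDegree p k * t - partialOffset X p k ≤ logGrowth X p t := by
  have h1 : ∑ m ∈ Finset.range k, 2 * (p m : ℝ) * (t - X m) ≤
      ∑' m, 2 * (p m : ℝ) * Real.log (1 + Real.exp t / Real.exp (X m)) := by
    refine le_trans (Finset.sum_le_sum fun m _ => ?_)
      ((hX.summable_logTerm t).sum_le_tsum _ fun m _ => logTerm_nonneg t m)
    exact mul_le_mul_of_nonneg_left (le_logTerm t m) (by positivity)
  have h2 : partialDegree p k * t - partialOffset X p k
      = 3 * t + ∑ m ∈ Finset.range k, 2 * (p m : ℝ) * (t - X m) := by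
    rw [partialDegree, partialOffset, add_mul, Finset.sum_mul, add_sub_assoc,
      ← Finset.sum_sub_distrib]
    simp [mul_sub]
  rw [h2, logGrowth, logFactors]
  linarith

theorem three_mul_le_logGrowth (hX : WellSeparated X p) (t : ℝ) : 3 * t ≤ logGrowth X p t := by
  simpa [partialDegree, partialOffset] using hX.sub_le_logGrowth 0 t

theorem logGrowth_le_affine (hX : WellSeparated X p) {k : ℕ} {t : ℝ} (h1 : ∀ m < k, 2 * X m ≤ t) (h2 : t ≤ X k / 2) :
    logGrowth X p t ≤ partialDegree p k * t - partialOffset X p k + 1 := by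
  have := tsum_le_of_le_tail (hX.summable_logTerm t) (k := k) (G := 0)
    (L := fun m => 2 * (p m : ℝ) * (t - X m)) fun m => ?_
  · rw [partialDegree, partialOffset, add_mul, Finset.sum_mul, add_sub_assoc,
      ← Finset.sum_sub_distrib, logGrowth, logFactors]
    simp only [mul_sub] at this
    linarith
  · rcases lt_or_ge m k with h | h
    · simpa [h, h.ne] using hX.logTerm_le_of_two_mul_le (h1 m h)
    · have := hX.logTerm_le_of_le_half (t := t) (m := m)
        (by linarith [hX.strictMono.monotone h])
      simpa [h.not_gt] using this

/-- Cruder than the affine bound, but usable for `t` close to earlier zeros as well. -/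
theorem logGrowth_le_linear (hX : WellSeparated X p) {k : ℕ} {t : ℝ} (h1 : 1 ≤ t) (h2 : t ≤ X k / 2) :
    logGrowth X p t ≤ partialDegree p k * t + 1 := by
  have := tsum_le_of_le_tail (hX.summable_logTerm t) (k := k) (G := 0)
    (L := fun m => 2 * (p m : ℝ) * t) fun m => ?_
  · rw [partialDegree, add_mul, Finset.sum_mul, logGrowth, logFactors]
    linarith
  · rcases lt_or_ge m k with h | h
    · have h3 := hX.logTerm_le_self (m := m) h1
      have h4 := mul_le_mul_of_nonneg_left h3 (show 0 ≤ 2 * (p m : ℝ) by positivity)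
      have h5 : (0 : ℝ) ≤ 1 / 2 / 2 ^ m := by positivity
      simp only [h, h.ne, if_true, if_false]
      linarith
    · have := hX.logTerm_le_of_le_half (t := t) (m := m)
        (by linarith [hX.strictMono.monotone h])
      simpa [h.not_gt] using this

theorem norm_neg_le (hX : WellSeparated X p) {k : ℕ} {t r G : ℝ} (h1 : ∀ m < k, 2 * X m ≤ t) (h2 : t ≤ X k)
    (hr : 0 ≤ r) (hrt : r ≤ Real.exp t)
    (hG : |1 - r / Real.exp (X k)| ^ (2 * p k) ≤ Real.exp G) :
    ‖canonicalProd (fun n => Real.exp (X n)) p ((-r : ℝ) : ℂ)‖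
      ≤ Real.exp (partialDegree p k * t - partialOffset X p k + 1 + G) := by
  set g : ℕ → ℝ := Function.update
    (fun m => 2 * (p m : ℝ) * Real.log (1 + Real.exp t / Real.exp (X m))) k G with hg_def
  have hg : Summable g := (hX.summable_logTerm t).update k G
  have hn : ‖((-r : ℝ) : ℂ)‖ = r := by simp [abs_of_nonneg hr]
  have hfac : ∀ m, ‖1 + ((-r : ℝ) : ℂ) / (Real.exp (X m) : ℂ)‖ = |1 - r / Real.exp (X m)| := by
    intro m
    rw [← Real.norm_eq_abs, ← Complex.norm_real]
    push_cast
    congr 1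
    ring
  have key := norm_canonicalProd_le (fun n => Real.exp_pos (X n)) hX.summable_div
    (z := ((-r : ℝ) : ℂ)) hg fun m => ?_
  · have hs := tsum_le_of_le_tail hg (k := k) (G := G)
      (L := fun m => 2 * (p m : ℝ) * (t - X m)) fun m => ?_
    · refine key.trans ?_
      rw [hn]
      have h3 : r ^ 3 ≤ Real.exp (3 * t) := by
        rw [show (3 : ℝ) * t = (3 : ℕ) * t by norm_num, Real.exp_nat_mul]
        gcongr
      calc r ^ 3 * Real.exp (∑' m, g m) ≤ Real.exp (3 * t) * Real.exp (∑' m, g m) := by gcongr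
        _ = Real.exp (3 * t + ∑' m, g m) := (Real.exp_add _ _).symm
        _ ≤ _ := by
            rw [Real.exp_le_exp, partialDegree, partialOffset, add_mul, Finset.sum_mul, add_sub_assoc,
              ← Finset.sum_sub_distrib]
            simp only [mul_sub] at hs
            linarith
    · rcases lt_trichotomy m k with h | rfl | h
      · simpa [g, h, h.ne] using hX.logTerm_le_of_two_mul_le (h1 m h)
      · have : (0 : ℝ) ≤ 1 / 2 / 2 ^ m := by positivity
        simpa [g] using this
      · have := hX.logTerm_le_of_le_half (t := t) (m := m)
          (by linarith [hX.four_mul_le h, hX.pos k])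
        simpa [g, h.not_gt, h.ne'] using this
  · rw [hfac]
    rcases eq_or_ne m k with rfl | h
    · simpa [g] using hG
    · simp only [g, Function.update_of_ne h]
      rw [exp_logFactor (a := fun n => Real.exp (X n)) (fun n => Real.exp_pos (X n))
        (Real.exp_pos t).le]
      refine pow_le_pow_left₀ (abs_nonneg _) ?_ _
      have h3 : r / Real.exp (X m) ≤ Real.exp t / Real.exp (X m) := by gcongr
      have h4 : 0 ≤ r / Real.exp (X m) := by positivity
      rw [abs_le]
      constructor <;> linarith

/-- Near the zero `-exp (X k)` and to its right, the product is bounded on the negative axis by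
its size at distance `exp ((1 - c) * X k)`. -/
theorem norm_neg_le_of_le_zero (hX : WellSeparated X p) {k : ℕ} {r c : ℝ} (hc0 : 0 ≤ c)
    (h1 : ∀ m < k, 2 * X m ≤ (1 - c) * X k)
    (hkill : partialDegree p k * (c * X k) ≤ 2 * p k * Real.exp (-(c * X k)))
    (hr : 0 ≤ r) (hrX : r ≤ Real.exp (X k)) :
    ‖canonicalProd (fun n => Real.exp (X n)) p ((-r : ℝ) : ℂ)‖
      ≤ Real.exp (partialDegree p k * ((1 - c) * X k) - partialOffset X p k + 1) := by
  have hk := hX.pos k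
  have hcX : 0 ≤ c * X k := by positivity
  have hs : r / Real.exp (X k) ≤ 1 := (div_le_one (Real.exp_pos _)).2 hrX
  have hs0 : 0 ≤ r / Real.exp (X k) := by positivity
  -- Far from the zero its factor is at most 1. Near it, 1 - s ≤ e^(-s) makes the factor so small
  -- that `hkill` compensates for evaluating the other factors at X_k instead of (1 - c)X_k.
  rcases le_total r (Real.exp ((1 - c) * X k)) with h | h
  · have := hX.norm_neg_le (k := k) (t := (1 - c) * X k) (G := 0) h1 (by linarith) hr h ?_
    · simpa using this
    · rw [Real.exp_zero]
      exact pow_le_one₀ (abs_nonneg _) (abs_le.2 ⟨by linarith, by linarith⟩)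
  · have hG : |1 - r / Real.exp (X k)| ^ (2 * p k)
        ≤ Real.exp (-(2 * p k * Real.exp (-(c * X k)))) := by
      have h3 : Real.exp (-(c * X k)) ≤ r / Real.exp (X k) := by
        rw [le_div_iff₀ (Real.exp_pos _), ← Real.exp_add]
        convert h using 2
        ring
      have h4 : |1 - r / Real.exp (X k)| ≤ Real.exp (-Real.exp (-(c * X k))) := by
        rw [abs_of_nonneg (by linarith)]
        have := Real.add_one_le_exp (-Real.exp (-(c * X k)))
        linarith
      calc _ ≤ Real.exp (-Real.exp (-(c * X k))) ^ (2 * p k) := by gcongr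
        _ = _ := by rw [← Real.exp_nat_mul]; push_cast; congr 1; ring
    refine (hX.norm_neg_le (k := k) (t := X k) ?_ le_rfl hr hrX hG).trans ?_
    · intro m hm
      linarith [h1 m hm]
    · rw [Real.exp_le_exp]
      linarith

end WellSeparated

end

/-! ### Affine recursions -/

/-- The iterates of the affine map `t ↦ D * t - C`. -/
noncomputable def affineIter (D C x : ℝ) : ℕ → ℝ
  | 0 => x
  | n + 1 => D * affineIter D C x n - C

theorem affineIter_eq {D : ℝ} (hD : D ≠ 1) (C x : ℝ) (n : ℕ) :
    affineIter D C x n = D ^ n * (x - C / (D - 1)) + C / (D - 1) := by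
  have h : D - 1 ≠ 0 := sub_ne_zero.2 hD
  induction n with
  | zero => simp [affineIter]
  | succ n ih =>
    rw [affineIter, ih]
    field_simp
    ring

/-- Both orbits grow like D^n times the distance of the start from the fixed point C/(D - 1), so
comparing these distances decides for large n. -/
theorem eventually_mul_affineIter_le {D : ℝ} (hD : 1 < D) {C C' x x' α β : ℝ}
    (h : β * (x' - C' / (D - 1)) < α * (x - C / (D - 1))) :
    ∀ᶠ n in atTop, β * affineIter D C' x' n ≤ α * affineIter D C x n := by
  have h1 : Tendsto (fun n => D ^ n * (α * (x - C / (D - 1)) - β * (x' - C' / (D - 1)))) atTop atTop :=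
    (tendsto_pow_atTop_atTop_of_one_lt hD).atTop_mul_const (by linarith)
  filter_upwards [h1.eventually_ge_atTop (β * (C' / (D - 1)) - α * (C / (D - 1)))] with n hn
  rw [affineIter_eq hD.ne', affineIter_eq hD.ne']
  linarith

theorem tendsto_affineIter {D : ℝ} (hD : 1 < D) {C x : ℝ} (h : C / (D - 1) < x) :
    Tendsto (affineIter D C x) atTop atTop := by
  have h1 : Tendsto (fun n => D ^ n * (x - C / (D - 1))) atTop atTop :=
    (tendsto_pow_atTop_atTop_of_one_lt hD).atTop_mul_const (by linarith)
  refine (tendsto_atTop_add_const_right _ (C / (D - 1)) h1).congr fun n => ?_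
  rw [affineIter_eq hD.ne']

/-! ### Inductive construction of the zeros -/

/-- The multiplicity parameter attached to a zero of modulus `exp x`. -/
noncomputable def multiplicity (d x : ℝ) : ℕ := ⌊Real.exp (d * x / 4) / 4⌋₊

/-- A stage of the construction of the zeros: `X` is the logarithm of the modulus of the zero to be
inserted, `prev` that of the previous one, `D` and `C` describe the affine growth `t ↦ D * t - C`
before `X`, `W` is the reference point with which `X` is compared, and `phase` counts how often the
reference point has been replaced by its predecessor. -/
structure Stage where
  X : ℝ
  prev : ℝ
  W : ℝ
  D : ℝ
  C : ℝ
  phase : ℕ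

namespace Stage

/-- Half the multiplicity of the zero inserted at a stage. -/
noncomputable def mult (S : Stage) (d : ℝ) : ℕ := multiplicity d S.X

/-- The degree after the insertion. -/
noncomputable def nextD (S : Stage) (d : ℝ) : ℝ := S.D + 2 * S.mult d

/-- The offset after the insertion. -/
noncomputable def nextC (S : Stage) (d : ℝ) : ℝ := S.C + 2 * S.mult d * S.X

/-- An upper bound, after one step, for the orbits on the negative axis. -/
noncomputable def upper (S : Stage) (d : ℝ) : ℝ := S.D * ((1 - d / 8) * S.X) - S.C + 1

/-- A lower bound, after one step, for the reference orbit. -/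
noncomputable def lower (S : Stage) : ℝ := S.D * S.W - S.C

/-- The conditions satisfied by every stage; `d` and `d'` are the present and the next exponent. -/
structure Invariant (S : Stage) (k : ℕ) (d d' : ℝ) : Prop where
  X_large : 30000 * S.D * (S.prev + 1) ≤ d * d' * S.X
  X_lower : 2 * ((k : ℝ) + 1) ≤ S.X
  prev_nonneg : 0 ≤ S.prev
  W_pos : 0 < S.W
  two_mul_le : 2 * S.X ≤ S.D * S.W
  three_le : 3 ≤ S.D
  C_nonneg : 0 ≤ S.C
  C_le : S.C ≤ S.D * S.prev

/-- The reference orbit has overtaken the zero by a factor `2`, after `m` steps. -/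
def Overtakes (S S' : Stage) (d : ℝ) (m : ℕ) : Prop :=
  2 * S'.X ≤ affineIter (S.nextD d) (S.nextC d) S.lower m

/-- `S'` is obtained from `S` by `m` steps of the affine growth after the insertion of `S.X`. -/
structure Step (S S' : Stage) (d : ℝ) (m : ℕ) : Prop where
  one_le : 1 ≤ m
  D_eq : S'.D = S.nextD d
  C_eq : S'.C = S.nextC d
  prev_eq : S'.prev = S.X
  X_eq : S'.X = affineIter (S.nextD d) (S.nextC d - 1) (S.upper d) m
  X_le : S'.X ≤ 3 / 2 * S.D * affineIter (S.nextD d) (S.nextC d) S.lower m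
  contract : 512 * S.X ≤ d * S.D * S.W → S.W * S'.X ≤
    (1 - d / 32) * S.X * affineIter (S.nextD d) (S.nextC d) S.lower m
  not_overtakes : ¬ Overtakes S S' d m →
    S'.W = affineIter (S.nextD d) (S.nextC d) S.lower m ∧ S'.phase = S.phase
  overtakes_of_ne : Overtakes S S' d m → S.phase ≠ 2 →
    S'.W = affineIter (S.nextD d) (S.nextC d) S.lower (m - 1) ∧ S'.phase = S.phase + 1
  overtakes_of_eq : Overtakes S S' d m → S.phase = 2 → S'.W = S'.X ∧ S'.phase = 0

namespace Invariant

variable {S : Stage} {k : ℕ} {d d' : ℝ}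

theorem X_pos (h : S.Invariant k d d') : 0 < S.X := by
  have := h.X_lower
  have : (0 : ℝ) ≤ k := k.cast_nonneg
  linarith

theorem dX_large (h : S.Invariant k d d') (hd : 0 < d) (hd2' : d' ≤ 1 / 2) :
    60000 * S.D * (S.prev + 1) ≤ d * S.X := by
  have h1 := h.X_large
  have h2 : d * d' * S.X ≤ d * (1 / 2) * S.X := by
    have := h.X_pos
    gcongr
  linarith

theorem dX_ge (h : S.Invariant k d d') (hd : 0 < d) (hd2' : d' ≤ 1 / 2) :
    60000 * S.D ≤ d * S.X ∧ 60000 * (S.D * S.prev) ≤ d * S.X := by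
  have h1 := h.dX_large hd hd2'
  have h2 := mul_nonneg (show 0 ≤ S.D by linarith [h.three_le]) h.prev_nonneg
  have := h.three_le
  constructor <;> nlinarith

theorem X_ge (h : S.Invariant k d d') (hd : 0 < d) (hd2 : d ≤ 1 / 2) (hd2' : d' ≤ 1 / 2) :
    120000 * S.D ≤ S.X ∧ 120000 * (S.D * S.prev) ≤ S.X := by
  have h1 := h.dX_ge hd hd2'
  have h2 : d * S.X ≤ 1 / 2 * S.X := by
    have := h.X_pos
    gcongr
  constructor <;> linarith [h1.1, h1.2]

theorem exp_ge (h : S.Invariant k d d') (hd' : 0 < d') :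
    7500 * S.D ≤ d' * Real.exp (d * S.X / 4) := by
  have h1 := Real.add_one_le_exp (d * S.X / 4)
  have h2 : d' * (d * S.X / 4) ≤ d' * Real.exp (d * S.X / 4) := by gcongr; linarith
  have h3 := h.X_large
  have := mul_nonneg (show 0 ≤ S.D by linarith [h.three_le]) h.prev_nonneg
  nlinarith

theorem mult_ge (h : S.Invariant k d d') (hd : 0 < d) (hd2' : d' ≤ 1 / 2) :
    Real.exp (d * S.X / 4) / 8 ≤ S.mult d := by
  have h1 := Real.add_one_le_exp (d * S.X / 4)
  have h2 := (h.dX_ge hd hd2').1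
  have h3 := Nat.lt_floor_add_one (Real.exp (d * S.X / 4) / 4)
  have := h.three_le
  rw [mult, multiplicity]
  linarith

theorem mult_le : (S.mult d : ℝ) ≤ Real.exp (d * S.X / 4) / 4 :=
  Nat.floor_le (by positivity)

/-- This is why `X_large` involves the next exponent: the new degree must dominate the old one even
after multiplication by `d'`, as `contract` needs one stage later. -/
theorem nextD_ge (h : S.Invariant k d d') (hd : 0 < d) (hd' : 0 < d') (hd2' : d' ≤ 1 / 2) :
    1600 * S.D ≤ d' * S.nextD d := by
  have h1 := h.exp_ge hd'
  have h2 := h.mult_ge hd hd2'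
  have h3 : d' * (Real.exp (d * S.X / 4) / 8) ≤ d' * S.mult d := by gcongr
  have h4 : 0 ≤ d' * S.D := mul_nonneg hd'.le (by linarith [h.three_le])
  rw [nextD]
  nlinarith

theorem nextD_ge_self (h : S.Invariant k d d') (hd : 0 < d) (hd' : 0 < d') (hd2' : d' ≤ 1 / 2) :
    3200 * S.D ≤ S.nextD d := by
  have h1 := h.nextD_ge hd hd' hd2'
  have h2 : 0 ≤ S.nextD d := add_nonneg (by linarith [h.three_le]) (by positivity)
  have h3 : d' * S.nextD d ≤ 1 / 2 * S.nextD d := by gcongr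
  linarith

/-- Says that the fixed point of the new affine map is at most `S.X`. -/
theorem nextC_le (h : S.Invariant k d d') (hd : 0 < d) (hd2 : d ≤ 1 / 2) (hd2' : d' ≤ 1 / 2) :
    S.nextC d ≤ (S.nextD d - 1) * S.X := by
  have h1 := (h.X_ge hd hd2 hd2').2
  have h2 := h.C_le
  have := h.three_le
  have := h.X_pos
  rw [nextC, nextD]
  nlinarith

theorem one_le_nextC (h : S.Invariant k d d') (hd : 0 < d) (hd2 : d ≤ 1 / 2) (hd2' : d' ≤ 1 / 2) :
    1 ≤ S.nextC d := by
  have h1 := h.mult_ge hd hd2'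
  have h2 := Real.add_one_le_exp (d * S.X / 4)
  have h3 := (h.dX_ge hd hd2').1
  have h4 := (h.X_ge hd hd2 hd2').1
  have := h.three_le
  have := h.C_nonneg
  rw [nextC]
  nlinarith

theorem two_mul_le_upper (h : S.Invariant k d d') (hd : 0 < d) (hd2 : d ≤ 1 / 2)
    (hd2' : d' ≤ 1 / 2) : 2 * S.X ≤ S.upper d := by
  have h1 := (h.X_ge hd hd2 hd2').2
  have h2 := h.C_le
  have h3 := h.three_le
  have h4 := h.X_pos
  have h5 : 3 * ((1 - d / 8) * S.X) ≤ S.D * ((1 - d / 8) * S.X) := by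
    have : 0 ≤ 1 - d / 8 := by linarith
    gcongr
  have h6 : d * S.X ≤ 1 / 2 * S.X := by gcongr
  rw [upper]
  linarith

/-- Keeps the upper orbit where the affine bound is valid: it never drops below 2X, and before the
last step it is at most half the next zero. -/
theorem doubling {t : ℝ} (h : S.Invariant k d d') (hd : 0 < d) (hd2 : d ≤ 1 / 2) (hd' : 0 < d')
    (hd2' : d' ≤ 1 / 2) (ht : 2 * S.X ≤ t) : 2 * t ≤ S.nextD d * t - (S.nextC d - 1) := by
  have h1 := h.nextC_le hd hd2 hd2'
  have h2 := h.nextD_ge_self hd hd' hd2'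
  have h3 := h.three_le
  have h4 := h.X_pos
  nlinarith [mul_le_mul_of_nonneg_left ht (show 0 ≤ S.nextD d - 2 by linarith)]

theorem two_mul_le_iter (h : S.Invariant k d d') (hd : 0 < d) (hd2 : d ≤ 1 / 2) (hd' : 0 < d')
    (hd2' : d' ≤ 1 / 2) (i : ℕ) :
    2 * S.X ≤ affineIter (S.nextD d) (S.nextC d - 1) (S.upper d) i := by
  induction i with
  | zero => exact h.two_mul_le_upper hd hd2 hd2'
  | succ i ih =>
    have := h.doubling hd hd2 hd' hd2' ih
    rw [affineIter]
    linarith [h.X_pos]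

theorem two_mul_iter_le (h : S.Invariant k d d') (hd : 0 < d) (hd2 : d ≤ 1 / 2) (hd' : 0 < d')
    (hd2' : d' ≤ 1 / 2) {i m : ℕ} (him : i < m) :
    2 * affineIter (S.nextD d) (S.nextC d - 1) (S.upper d) i ≤
      affineIter (S.nextD d) (S.nextC d - 1) (S.upper d) m := by
  induction m, him using Nat.le_induction with
  | base => exact h.doubling hd hd2 hd' hd2' (h.two_mul_le_iter hd hd2 hd' hd2' i)
  | succ m _ ih =>
    have h1 := h.doubling hd hd2 hd' hd2' (h.two_mul_le_iter hd hd2 hd' hd2' m)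
    have h2 := h.two_mul_le_iter hd hd2 hd' hd2' m
    have := h.X_pos
    rw [affineIter]
    linarith

theorem offset_div_le (h : S.Invariant k d d') (hd : 0 < d) (hd2 : d ≤ 1 / 2) (hd' : 0 < d')
    (hd2' : d' ≤ 1 / 2) : S.nextC d / (S.nextD d - 1) ≤ S.X := by
  have := h.nextD_ge_self hd hd' hd2'
  have := h.three_le
  exact (div_le_iff₀ (by linarith)).2 (by linarith [h.nextC_le hd hd2 hd2'])

theorem upper_sub_le (h : S.Invariant k d d') (hd : 0 < d) (hd2 : d ≤ 1 / 2) (hd' : 0 < d')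
    (hd2' : d' ≤ 1 / 2) :
    S.upper d - (S.nextC d - 1) / (S.nextD d - 1) ≤ S.D * ((1 - d / 8) * S.X) + 1 := by
  have := h.nextD_ge_self hd hd' hd2'
  have := h.three_le
  have hτ' : 0 ≤ (S.nextC d - 1) / (S.nextD d - 1) :=
    div_nonneg (by linarith [h.one_le_nextC hd hd2 hd2']) (by linarith)
  rw [upper]
  linarith [h.C_nonneg]

theorem le_lower_sub (h : S.Invariant k d d') (hd : 0 < d) (hd2 : d ≤ 1 / 2) (hd' : 0 < d')
    (hd2' : d' ≤ 1 / 2) :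
    S.D * S.W - S.X - S.D * S.prev ≤ S.lower - S.nextC d / (S.nextD d - 1) := by
  have := h.offset_div_le hd hd2 hd' hd2'
  rw [lower]
  linarith [h.C_le]

/-- As the next degree is at least 3200 D, this bound preserves `two_mul_le` when the reference
point is not replaced. It also supplies the hypothesis of `contract` at the following stage. -/
theorem eventually_le (h : S.Invariant k d d') (hd : 0 < d) (hd2 : d ≤ 1 / 2) (hd' : 0 < d')
    (hd2' : d' ≤ 1 / 2) : ∀ᶠ m in atTop,
      affineIter (S.nextD d) (S.nextC d - 1) (S.upper d) m ≤
      3 / 2 * S.D * affineIter (S.nextD d) (S.nextC d) S.lower m := by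
  have hX := h.X_pos
  have hD3 := h.three_le
  have hD' := h.nextD_ge_self hd hd' hd2'
  have hXg := h.X_ge hd hd2 hd2'
  have hup := h.upper_sub_le hd hd2 hd' hd2'
  have hlow := h.le_lower_sub hd hd2 hd' hd2'
  have key := eventually_mul_affineIter_le (D := S.nextD d) (by linarith) (C := S.nextC d)
    (C' := S.nextC d - 1) (x := S.lower) (x' := S.upper d) (α := 3 / 2 * S.D) (β := 1) ?_
  · simpa only [one_mul] using key
  · have h1 : S.D * ((1 - d / 8) * S.X) ≤ S.D * S.X := by
      have : (1 - d / 8) * S.X ≤ 1 * S.X := by gcongr; linarith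
      gcongr
      linarith
    have h2 : 3 / 2 * S.D * (S.X - S.X / 120000) ≤
        3 / 2 * S.D * (S.lower - S.nextC d / (S.nextD d - 1)) := by
      have := h.two_mul_le
      exact mul_le_mul_of_nonneg_left (by linarith) (by linarith)
    nlinarith

/-- The distances to the fixed points are about (1 - d/8)DX and at least (1 - d/500)DW. The gap
between d/8 and d/32 absorbs all errors. -/
theorem eventually_contract (h : S.Invariant k d d') (hd : 0 < d) (hd2 : d ≤ 1 / 2) (hd' : 0 < d')
    (hd2' : d' ≤ 1 / 2) (hc : 512 * S.X ≤ d * S.D * S.W) : ∀ᶠ m in atTop,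
      S.W * affineIter (S.nextD d) (S.nextC d - 1) (S.upper d) m ≤
      (1 - d / 32) * S.X * affineIter (S.nextD d) (S.nextC d) S.lower m := by
  have hX := h.X_pos
  have hW := h.W_pos
  have hD3 := h.three_le
  have hD' := h.nextD_ge_self hd hd' hd2'
  have hXg := h.X_ge hd hd2 hd2'
  have hdX := h.dX_ge hd hd2'
  have hup := h.upper_sub_le hd hd2 hd' hd2'
  have hlow := h.le_lower_sub hd hd2 hd' hd2'
  refine eventually_mul_affineIter_le (by linarith) ?_
  set U := S.D * S.W with hU
  have hU0 : 0 < U := by positivity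
  have h1 : (1 - d / 500) * U ≤ S.lower - S.nextC d / (S.nextD d - 1) := by
    linarith
  have h2 : (1 - d / 32) * S.X * ((1 - d / 500) * U) ≤
      (1 - d / 32) * S.X * (S.lower - S.nextC d / (S.nextD d - 1)) := by
    have : 0 ≤ 1 - d / 32 := by linarith
    gcongr
  have h3 : S.W * (S.upper d - (S.nextC d - 1) / (S.nextD d - 1)) ≤
      (1 - d / 8) * (S.X * U) + S.W := by
    calc _ ≤ S.W * (S.D * ((1 - d / 8) * S.X) + 1) := by gcongr
      _ = _ := by rw [hU]; ring
  have h4 : S.W < d / 1000 * (S.X * U) := by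
    have : 1000 < S.D * (d * S.X) := by nlinarith
    rw [hU]
    nlinarith
  have h5 : 0 < S.X * U := by positivity
  have h6 : 0 < d * (S.X * U) := by positivity
  have h7 : 0 < d * (d * (S.X * U)) := by positivity
  nlinarith

/-- The next zero is the upper orbit at time `m` itself. All requirements hold for large `m`: the
comparisons by the growth of affine orbits, the size conditions because the upper orbit tends to
infinity. -/
theorem exists_step (h : S.Invariant k d d') (hd : 0 < d) (hd2 : d ≤ 1 / 2) (hd' : 0 < d')
    (hd2' : d' ≤ 1 / 2) {d'' : ℝ} (hd'' : 0 < d'') :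
    ∃ (S' : Stage) (m : ℕ), S'.Invariant (k + 1) d' d'' ∧ S.Step S' d m := by
  have hX := h.X_pos
  have hD3 := h.three_le
  have hD' := h.nextD_ge_self hd hd' hd2'
  have hD1 : 1 < S.nextD d := by linarith
  have hτ := h.offset_div_le hd hd2 hd' hd2'
  have hτ2 : (S.nextC d - 1) / (S.nextD d - 1) ≤ S.nextC d / (S.nextD d - 1) :=
    div_le_div_of_nonneg_right (by linarith) (by linarith)
  have e3 : Tendsto (affineIter (S.nextD d) (S.nextC d - 1) (S.upper d)) atTop atTop :=
    tendsto_affineIter hD1 (by linarith [h.two_mul_le_upper hd hd2 hd2'])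
  have e4 : ∀ᶠ m in atTop, 512 * S.X ≤ d * S.D * S.W →
      S.W * affineIter (S.nextD d) (S.nextC d - 1) (S.upper d) m ≤
      (1 - d / 32) * S.X * affineIter (S.nextD d) (S.nextC d) S.lower m := by
    by_cases hc : 512 * S.X ≤ d * S.D * S.W
    · filter_upwards [h.eventually_contract hd hd2 hd' hd2' hc] with m hm _ using hm
    · exact .of_forall fun m hm => absurd hm hc
  obtain ⟨m, hm1, hm2, hm3, hm4, hm5⟩ := ((h.eventually_le hd hd2 hd' hd2').and (e4.and ((eventually_ge_atTop 1).and
    ((e3.eventually_ge_atTop (30000 * S.nextD d * (S.X + 1) / (d' * d''))).and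
    (e3.eventually_ge_atTop (2 * (((k + 1 : ℕ) : ℝ) + 1))))))).exists
  set x' := affineIter (S.nextD d) (S.nextC d - 1) (S.upper d) m with hx'
  set w := affineIter (S.nextD d) (S.nextC d) S.lower m with hw
  have hx'0 : 0 < x' := by
    have : (0 : ℝ) ≤ (k + 1 : ℕ) := Nat.cast_nonneg _
    linarith
  have hXl : 30000 * S.nextD d * (S.X + 1) ≤ d' * d'' * x' := by
    rwa [div_le_iff₀' (by positivity)] at hm4
  have hC0 := h.one_le_nextC hd hd2 hd2'
  have hCle : S.nextC d ≤ S.nextD d * S.X := by linarith [h.nextC_le hd hd2 hd2']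
  have hw0 : 0 < w := by
    by_contra! hneg
    nlinarith
  by_cases hov : 2 * x' ≤ w
  · by_cases hph : S.phase = 2
    · refine ⟨⟨x', S.X, x', S.nextD d, S.nextC d, 0⟩, m,
        ⟨hXl, hm5, hX.le, hx'0, ?_, ?_, by simp only; linarith, hCle⟩,
        ⟨hm3, rfl, rfl, rfl, rfl, by simp only; linarith, hm2, ?_, ?_, ?_⟩⟩
      · simp only; nlinarith
      · simp only; linarith
      · exact fun hn => absurd hov hn
      · exact fun _ hn => absurd hph hn
      · exact fun _ _ => ⟨rfl, rfl⟩
    -- The predecessor is still a legitimate reference point: one more affine step from it reaches w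
    -- ≥ 2x', which gives `two_mul_le`.
    · obtain ⟨n, rfl⟩ : ∃ n, m = n + 1 := ⟨m - 1, by omega⟩
      have hwn : w ≤ S.nextD d * affineIter (S.nextD d) (S.nextC d) S.lower n := by
        rw [hw, affineIter]; linarith
      refine ⟨⟨x', S.X, affineIter (S.nextD d) (S.nextC d) S.lower n, S.nextD d, S.nextC d,
        S.phase + 1⟩, n + 1,
        ⟨hXl, hm5, hX.le, ?_, ?_, ?_, by simp only; linarith, hCle⟩,
        ⟨hm3, rfl, rfl, rfl, rfl, by simp only; linarith, hm2, ?_, ?_, ?_⟩⟩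
      · exact pos_of_mul_pos_right (hw0.trans_le hwn) (by linarith)
      · simp only; linarith
      · simp only; linarith
      · exact fun hn => absurd hov hn
      · exact fun _ _ => ⟨rfl, rfl⟩
      · exact fun _ hn => absurd hn hph
  · refine ⟨⟨x', S.X, w, S.nextD d, S.nextC d, S.phase⟩, m,
        ⟨hXl, hm5, hX.le, hw0, ?_, ?_, by simp only; linarith, hCle⟩,
        ⟨hm3, rfl, rfl, rfl, rfl, by simp only; linarith, hm2, ?_, ?_, ?_⟩⟩
    · simp only
      have : 3 * S.D * w ≤ S.nextD d * w := by gcongr; linarith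
      linarith
    · simp only; linarith
    · exact fun _ => ⟨rfl, rfl⟩
    · exact fun hn => absurd hn hov
    · exact fun hn => absurd hn hov

end Invariant

end Stage

/-! ### Sequences of stages: overtaking recurs -/

/-- The stages `S k` follow each other by `m k` steps of affine growth. -/
structure IsStageSeq (d : ℕ → ℝ) (S : ℕ → Stage) (m : ℕ → ℕ) : Prop where
  inv : ∀ k, (S k).Invariant k (d k) (d (k + 1))
  step : ∀ k, (S k).Step (S (k + 1)) (d k) (m k)
  D_zero : (S 0).D = 3
  C_zero : (S 0).C = 0
  W_zero : (S 0).W = (S 0).X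
  phase_zero : (S 0).phase = 0

/-- A sequence of stages, each obtained from the previous one. -/
structure StageSeq (d : ℕ → ℝ) where
  S : ℕ → Stage
  m : ℕ → ℕ
  spec : IsStageSeq d S m

theorem StageSeq.nonempty {d : ℕ → ℝ} (hd : ∀ k, 0 < d k) (hd2 : ∀ k, d k ≤ 1 / 2) :
    Nonempty (StageSeq d) := by
  -- 90000 is 30000 D (prev + 1) for D = 3 and prev = 0.
  obtain ⟨x, hx2, hx⟩ : ∃ x, 2 ≤ x ∧ 90000 ≤ d 0 * d 1 * x :=
    ⟨max 2 (90000 / (d 0 * d 1)), le_max_left _ _,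
      (div_le_iff₀' (mul_pos (hd 0) (hd 1))).1 (le_max_right _ _)⟩
  have hI : Stage.Invariant ⟨x, 0, x, 3, 0, 0⟩ 0 (d 0) (d (0 + 1)) :=
    ⟨by simp only; norm_num at hx ⊢; linarith, by simpa using hx2, le_rfl, by simp only; linarith,
      by simp only; linarith, le_rfl, le_rfl, by simp⟩
  have hstep : ∀ (k : ℕ) (S : {S : Stage // S.Invariant k (d k) (d (k + 1))}),
      ∃ (S' : {S : Stage // S.Invariant (k + 1) (d (k + 1)) (d (k + 1 + 1))}) (m : ℕ),
        S.1.Step S'.1 (d k) m := by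
    rintro k ⟨S, hS⟩
    obtain ⟨S', m, h1, h2⟩ := hS.exists_step (hd k) (hd2 k) (hd (k + 1)) (hd2 (k + 1)) (hd (k + 1 + 1))
    exact ⟨⟨S', h1⟩, m, h2⟩
  choose F M hF using hstep
  let T : (k : ℕ) → {S : Stage // S.Invariant k (d k) (d (k + 1))} :=
    fun k => Nat.rec ⟨_, hI⟩ (fun k S => F k S) k
  exact ⟨⟨fun k => (T k).1, fun k => M k (T k), ⟨fun k => (T k).2, fun k => hF k (T k),
    rfl, rfl, rfl, rfl⟩⟩⟩

namespace StageSeq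

variable {d : ℕ → ℝ}

/-- Logarithms of the moduli of the zeros. -/
def X (A : StageSeq d) (k : ℕ) : ℝ := (A.S k).X

/-- Half the multiplicities of the zeros. -/
noncomputable def p (A : StageSeq d) (k : ℕ) : ℕ := multiplicity (d k) (A.X k)

theorem D_eq (A : StageSeq d) (k : ℕ) : (A.S k).D = partialDegree A.p k := by
  induction k with
  | zero => simp [partialDegree, A.spec.D_zero]
  | succ k ih =>
    rw [(A.spec.step k).D_eq, Stage.nextD, ih, partialDegree, partialDegree, Finset.sum_range_succ,
      add_assoc]
    rfl

theorem C_eq (A : StageSeq d) (k : ℕ) : (A.S k).C = partialOffset A.X A.p k := by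
  induction k with
  | zero => simp [partialOffset, A.spec.C_zero]
  | succ k ih =>
    rw [(A.spec.step k).C_eq, Stage.nextC, ih, partialOffset, partialOffset, Finset.sum_range_succ]
    rfl

/-- Stage `k` ends with the reference orbit overtaking the next zero. -/
def Event (A : StageSeq d) (k : ℕ) : Prop :=
  (A.S k).Overtakes (A.S (k + 1)) (d k) (A.m k)

/-- Without events, v = X/W stays at least 1/2 and shrinks by the factor 1 - d/32, hence drops by at
least d/64 each time. Telescoping would bound the partial sums of `d`. -/
theorem exists_event (A : StageSeq d) (hd : ∀ k, 0 < d k) (hd2 : ∀ k, d k ≤ 1 / 2)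
    (hs : ¬ Summable d) (K : ℕ) : ∃ k, K ≤ k ∧ A.Event k := by
  by_contra! hno
  have hW : ∀ k, K ≤ k → (A.S (k + 1)).W =
      affineIter ((A.S k).nextD (d k)) ((A.S k).nextC (d k)) (A.S k).lower (A.m k) :=
    fun k hk => ((A.spec.step k).not_overtakes (hno k hk)).1
  set v : ℕ → ℝ := fun k => (A.S k).X / (A.S k).W with hv
  have hhalf : ∀ k, K ≤ k → 1 / 2 ≤ v (k + 1) := by
    intro k hk
    have h1 := hno k hk
    rw [Event, Stage.Overtakes, not_le, ← hW k hk] at h1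
    rw [hv]
    simp only
    rw [le_div_iff₀ (A.spec.inv (k + 1)).W_pos]
    linarith
  have hdec : ∀ k, K ≤ k → v (k + 2) ≤ v (k + 1) - d (k + 1) / 64 := by
    intro k hk
    have hWp := (A.spec.inv (k + 1)).W_pos
    have hWp' := (A.spec.inv (k + 2)).W_pos
    have h1 := (A.spec.step k).X_le
    rw [← hW k hk] at h1
    have h2 := (A.spec.inv k).nextD_ge (hd k) (hd (k + 1)) (hd2 (k + 1))
    rw [← (A.spec.step k).D_eq] at h2
    -- 512 · 3/2 = 768 ≤ 1600; the absence of an event at stage `k` is used here to identify the new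
    -- W in `X_le`.
    have h3 := (A.spec.step (k + 1)).contract (by
      have : 1600 * (A.S k).D * (A.S (k + 1)).W ≤ d (k + 1) * (A.S (k + 1)).D * (A.S (k + 1)).W := by
        gcongr
      have := (A.spec.inv (k + 1)).X_pos
      linarith)
    rw [← hW (k + 1) (by omega)] at h3
    have h4 : v (k + 2) ≤ (1 - d (k + 1) / 32) * v (k + 1) := by
      rw [hv]
      simp only
      rw [← mul_div_assoc, div_le_div_iff₀ hWp' hWp]
      linarith
    have h5 := mul_le_mul_of_nonneg_left (hhalf k hk) (hd (k + 1)).le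
    linarith
  have hsum : ∀ n, ∑ i ∈ Finset.range n, d (i + (K + 1)) ≤ 64 * (v (K + 1) - v (K + 1 + n)) := by
    intro n
    induction n with
    | zero => simp
    | succ n ih =>
      rw [Finset.sum_range_succ]
      have := hdec (K + n) (by omega)
      rw [show K + n + 2 = K + 1 + (n + 1) by ring, show K + n + 1 = K + 1 + n by ring] at this
      rw [show n + (K + 1) = K + 1 + n by ring]
      linarith
  apply hs
  rw [← summable_nat_add_iff (K + 1)]
  refine summable_of_sum_range_le (c := 64 * v (K + 1)) (fun n => (hd _).le) fun n => ?_
  have h1 := hhalf (K + n) (by omega)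
  rw [show K + n + 1 = K + 1 + n by ring] at h1
  linarith [hsum n]

theorem wellSeparated (A : StageSeq d) (hd : ∀ k, 0 < d k) (hd2 : ∀ k, d k ≤ 1 / 2) :
    WellSeparated A.X A.p where
  lower k := (A.spec.inv k).X_lower
  ratio k := by
    have h1 := ((A.spec.inv (k + 1)).X_ge (hd _) (hd2 _) (hd2 _)).2
    rw [(A.spec.step k).prev_eq] at h1
    have := (A.spec.inv (k + 1)).three_le
    have := (A.spec.inv k).X_pos
    change 4 * (A.S k).X ≤ (A.S (k + 1)).X
    nlinarith
  mult_le k := by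
    have h1 : (A.p k : ℝ) ≤ Real.exp (d k * A.X k / 4) / 4 := Nat.floor_le (by positivity)
    have h2 : Real.exp (d k * A.X k / 4) ≤ Real.exp (A.X k / 8) := by
      have : d k * A.X k ≤ 1 / 2 * A.X k := by
        have : 0 ≤ A.X k := (A.spec.inv k).X_pos.le
        gcongr
        exact hd2 k
      rw [Real.exp_le_exp]
      linarith
    linarith
  mult_pos k := by
    have h1 := (A.spec.inv k).mult_ge (hd k) (hd2 _)
    have : 0 < Real.exp (d k * (A.S k).X / 4) / 8 := by positivity
    have h2 : (0 : ℝ) < (A.S k).mult (d k) := by linarith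
    exact_mod_cast h2

end StageSeq

/-! ### Iteration of log M -/

namespace WellSeparated

variable {X : ℕ → ℝ} {p : ℕ → ℕ}

theorem logGrowth_sub_le (hX : WellSeparated X p) {s t : ℝ} (hst : s ≤ t) :
    logGrowth X p s - 3 * s ≤ logGrowth X p t - 3 * t := by
  unfold logGrowth logFactors
  have := (hX.summable_logTerm s).tsum_le_tsum (fun m => ?_) (hX.summable_logTerm t)
  · linarith
  · gcongr

theorem norm_le_exp_logGrowth (hX : WellSeparated X p) {t : ℝ} {z : ℂ} (hz : ‖z‖ ≤ Real.exp t) :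
    ‖canonicalProd (fun n => Real.exp (X n)) p z‖ ≤ Real.exp (logGrowth X p t) := by
  have h0 : ∀ n, 0 < Real.exp (X n) := fun n => Real.exp_pos (X n)
  refine (norm_canonicalProd_le_logFactors h0 hX.summable_div z).trans ?_
  rw [logGrowth, Real.exp_add, show (3 : ℝ) * t = (3 : ℕ) * t by norm_num, Real.exp_nat_mul]
  have h1 : logFactors (fun n => Real.exp (X n)) p ‖z‖ ≤
      logFactors (fun n => Real.exp (X n)) p (Real.exp t) := by
    refine (summable_logFactors h0 hX.summable_div (norm_nonneg z)).tsum_le_tsum (fun m => ?_)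
      (hX.summable_logTerm t)
    gcongr
  gcongr

/-- Since ψ(t) - 3t is nondecreasing, increments do not shrink. Unlike ψ(t) ≥ 3t this also makes
orbits with negative `t` grow, so admissible R < 1 are covered. -/
theorem add_le_iterate (hX : WellSeparated X p) {t η : ℝ} (hη : 0 ≤ η)
    (h : t + η ≤ logGrowth X p t) (n : ℕ) : t + n * η ≤ (logGrowth X p)^[n] t := by
  induction n with
  | zero => simp
  | succ n ih =>
    rw [Function.iterate_succ_apply']
    have h0 : (0 : ℝ) ≤ n * η := by positivity
    have h1 := hX.logGrowth_sub_le (show t ≤ (logGrowth X p)^[n] t by linarith)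
    push_cast
    linarith

theorem maxModulusIter_exp (hX : WellSeparated X p) (t : ℝ) (n : ℕ) :
    maxModulusIter (canonicalProd (fun n => Real.exp (X n)) p) (Real.exp t) n
      = Real.exp ((logGrowth X p)^[n] t) := by
  induction n with
  | zero => rfl
  | succ n ih =>
    rw [maxModulusIter, Function.iterate_succ_apply', Function.iterate_succ_apply']
    rw [maxModulusIter] at ih
    rw [ih, hX.exp_logGrowth]

theorem iterate_lt_succ (hX : WellSeparated X p) {t : ℝ} (ht : 0 < t) (n : ℕ) :
    0 < (logGrowth X p)^[n] t ∧
      3 * (logGrowth X p)^[n] t ≤ (logGrowth X p)^[n + 1] t := by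
  have h : ∀ n, 0 < (logGrowth X p)^[n] t := by
    intro n
    induction n with
    | zero => exact ht
    | succ n ih =>
      rw [Function.iterate_succ_apply']
      linarith [hX.three_mul_le_logGrowth ((logGrowth X p)^[n] t)]
  refine ⟨h n, ?_⟩
  rw [Function.iterate_succ_apply']
  exact hX.three_mul_le_logGrowth _

theorem strictMono_iterate (hX : WellSeparated X p) {t : ℝ} (ht : 0 < t) :
    StrictMono fun n => (logGrowth X p)^[n] t :=
  strictMono_nat_of_lt_succ fun n => by
    have := hX.iterate_lt_succ ht n
    linarith

theorem pow_mul_le_iterate (hX : WellSeparated X p) {t : ℝ} (ht : 0 < t) (k n : ℕ) :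
    3 ^ n * (logGrowth X p)^[k] t ≤ (logGrowth X p)^[k + n] t := by
  induction n with
  | zero => simp
  | succ n ih =>
    have := (hX.iterate_lt_succ ht (k + n)).2
    rw [pow_succ, ← add_assoc]
    linarith

theorem tendsto_iterate (hX : WellSeparated X p) {t : ℝ} (ht : 0 < t) :
    Tendsto (fun n => (logGrowth X p)^[n] t) atTop atTop := by
  refine tendsto_atTop_mono (fun n => ?_)
    ((tendsto_pow_atTop_atTop_of_one_lt (r := (3 : ℝ)) (by norm_num)).atTop_mul_const ht)
  simpa using hX.pow_mul_le_iterate ht 0 n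

/-- Between which two iterates a given level lies. -/
theorem exists_iterate_le_lt (hX : WellSeparated X p) {t : ℝ} (ht : 0 < t) {B : ℕ} {x : ℝ}
    (hB : (logGrowth X p)^[B] t ≤ x) :
    ∃ n, B ≤ n ∧ (logGrowth X p)^[n] t ≤ x ∧ x < (logGrowth X p)^[n + 1] t := by
  have hex : ∃ n, x < (logGrowth X p)^[n] t := ((hX.tendsto_iterate ht).eventually_gt_atTop x).exists
  classical
  have h1 := Nat.find_spec hex
  have hBf : B < Nat.find hex := by
    by_contra! hle
    have := (hX.strictMono_iterate ht).monotone hle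
    linarith
  obtain ⟨n, hn⟩ : ∃ n, Nat.find hex = n + 1 := ⟨Nat.find hex - 1, by omega⟩
  refine ⟨n, by omega, ?_, by rwa [hn] at h1⟩
  by_contra! hlt
  exact Nat.find_min hex (m := n) (by omega) hlt

end WellSeparated

/-! ### Negative orbits lag behind -/

namespace StageSeq

variable {d : ℕ → ℝ}

/-- `log M (exp t)` for the product defined by a sequence of stages. -/
noncomputable def psi (A : StageSeq d) : ℝ → ℝ := logGrowth A.X A.p

/-- The entire function defined by a sequence of stages. -/
noncomputable def func (A : StageSeq d) : ℂ → ℂ :=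
  canonicalProd (fun n => Real.exp (A.X n)) A.p

theorem norm_func_neg_le (A : StageSeq d) (hd : ∀ k, 0 < d k) (hd2 : ∀ k, d k ≤ 1 / 2) {k : ℕ}
    {r : ℝ} (hr : 0 ≤ r) (hrX : r ≤ Real.exp (A.X k)) :
    ‖A.func ((-r : ℝ) : ℂ)‖ ≤ Real.exp ((A.S k).upper (d k)) := by
  have hX := A.wellSeparated hd hd2
  have hXk := hX.pos k
  -- With c = d/8 and u = cX, the multiplicity is at least e^(2u)/8, so the gain 2p e^(-u) ≥ e^u/4
  -- beats the cost D u because u ≥ 8D.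
  have h1 := hX.norm_neg_le_of_le_zero (k := k) (c := d k / 8) (by linarith [hd k]) ?_ ?_ hr hrX
  · rwa [← A.D_eq, ← A.C_eq] at h1
  · intro m hm
    have h2 := hX.four_mul_le hm
    have h3 := mul_le_mul_of_nonneg_right (hd2 k) hXk.le
    linarith
  · rw [← A.D_eq]
    have h2 : Real.exp (d k * A.X k / 4) / 8 ≤ A.p k := (A.spec.inv k).mult_ge (hd k) (hd2 _)
    have h3 : 60000 * (A.S k).D ≤ d k * A.X k := ((A.spec.inv k).dX_ge (hd k) (hd2 _)).1
    have h4 := (A.spec.inv k).three_le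
    set u := d k / 8 * A.X k with hu
    have hu0 : 0 < u := by have := hd k; positivity
    rw [show d k * A.X k / 4 = u + u by rw [hu]; ring, Real.exp_add] at h2
    have h5 := Real.quadratic_le_exp_of_nonneg hu0.le
    have h6 : Real.exp u * Real.exp (-u) = 1 := by rw [← Real.exp_add]; simp
    have h7 : Real.exp u * Real.exp u / 8 * Real.exp (-u) ≤ A.p k * Real.exp (-u) := by gcongr
    have h8 : Real.exp u * Real.exp u / 8 * Real.exp (-u) = Real.exp u / 8 := by
      rw [mul_div_assoc, mul_assoc, div_mul_eq_mul_div, h6]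
      ring
    have h9 : (A.S k).D * u ≤ u ^ 2 / 8 := by
      have : 8 * (A.S k).D ≤ u := by linarith
      nlinarith
    linarith

/-- The moduli of an orbit on the negative real axis, as far as they matter for its escape. -/
structure IsNegOrbit (A : StageSeq d) (ρ : ℕ → ℝ) : Prop where
  attracted : ∀ n k, ρ n ≤ Real.exp (A.X k) → ρ (n + 1) ≤ Real.exp ((A.S k).upper (d k))
  growth : ∀ n t, ρ n ≤ Real.exp t → ρ (n + 1) ≤ Real.exp (A.psi t)

/-- At time `T` the orbit `ρ` is below the zero of index `k`, and the reference orbit of `t` is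
above the reference point at time `N`. -/
def Reference (A : StageSeq d) (ρ : ℕ → ℝ) (t : ℝ) (k T N : ℕ) : Prop :=
  ρ T ≤ Real.exp (A.X k) ∧ (A.S k).W ≤ A.psi^[N] t

theorem advance_upper (A : StageSeq d) (hd : ∀ k, 0 < d k) (hd2 : ∀ k, d k ≤ 1 / 2) {ρ : ℕ → ℝ}
    (hρ : A.IsNegOrbit ρ) {k T : ℕ} (h : ρ T ≤ Real.exp (A.X k)) :
    ρ (T + 1 + A.m k) ≤ Real.exp (A.X (k + 1)) := by
  have hX := A.wellSeparated hd hd2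
  have hinv := A.spec.inv k
  have hstep := A.spec.step k
  have key : ∀ i ≤ A.m k, ρ (T + 1 + i) ≤ Real.exp
      (affineIter ((A.S k).nextD (d k)) ((A.S k).nextC (d k) - 1) ((A.S k).upper (d k)) i) := by
    intro i
    induction i with
    | zero => exact fun _ => hρ.attracted T k h
    | succ i ih =>
      intro hi
      refine (hρ.growth _ _ (ih (by omega))).trans (Real.exp_le_exp.2 ?_)
      have h1 := hinv.two_mul_le_iter (hd k) (hd2 k) (hd _) (hd2 _) i
      have h2 := hinv.two_mul_iter_le (hd k) (hd2 k) (hd _) (hd2 _) (show i < A.m k by omega)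
      rw [← hstep.X_eq] at h2
      have h3 := hX.logGrowth_le_affine (k := k + 1) (t := affineIter ((A.S k).nextD (d k))
        ((A.S k).nextC (d k) - 1) ((A.S k).upper (d k)) i) ?_ ?_
      · rw [← A.D_eq, ← A.C_eq, hstep.D_eq, hstep.C_eq] at h3
        rw [affineIter, psi]
        linarith
      · intro m hm
        have : A.X m ≤ A.X k := hX.strictMono.monotone (by omega)
        change 2 * A.X k ≤ _ at h1
        linarith
      · change _ ≤ A.X (k + 1) at h2
        linarith
  have := key _ le_rfl
  rwa [← hstep.X_eq] at this

theorem advance_lower (A : StageSeq d) (hd : ∀ k, 0 < d k) (hd2 : ∀ k, d k ≤ 1 / 2) {t : ℝ}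
    {k N : ℕ} (h : (A.S k).W ≤ A.psi^[N] t) (i : ℕ) :
    affineIter ((A.S k).nextD (d k)) ((A.S k).nextC (d k)) (A.S k).lower i
      ≤ A.psi^[N + 1 + i] t := by
  have hX := A.wellSeparated hd hd2
  have key : ∀ j {n w}, w ≤ A.psi^[n] t → (A.S j).D * w - (A.S j).C ≤ A.psi^[n + 1] t := by
    intro j n w hw
    have h1 := hX.sub_le_logGrowth j (A.psi^[n] t)
    have h2 : (A.S j).D * w ≤ (A.S j).D * A.psi^[n] t := by
      have := (A.spec.inv j).three_le
      gcongr
    rw [← A.D_eq, ← A.C_eq] at h1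
    rw [Function.iterate_succ_apply', psi]
    rw [psi] at h1 h2
    linarith
  induction i with
  | zero => exact key k h
  | succ i ih =>
    have := key (k + 1) ih
    rwa [(A.spec.step k).D_eq, (A.spec.step k).C_eq] at this

theorem Reference.step {A : StageSeq d} {ρ : ℕ → ℝ} {t : ℝ} {k T N : ℕ}
    (h : A.Reference ρ t k T N) (hd : ∀ k, 0 < d k) (hd2 : ∀ k, d k ≤ 1 / 2)
    (hρ : A.IsNegOrbit ρ) (hk : ¬ A.Event k) :
    A.Reference ρ t (k + 1) (T + 1 + A.m k) (N + 1 + A.m k) :=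
  ⟨A.advance_upper hd hd2 hρ h.1, by
    rw [((A.spec.step k).not_overtakes hk).1]; exact A.advance_lower hd hd2 h.2 _⟩

theorem exists_first_event (A : StageSeq d) (hd : ∀ k, 0 < d k) (hd2 : ∀ k, d k ≤ 1 / 2)
    (hs : ¬ Summable d) (K : ℕ) : ∃ n, A.Event (K + n) ∧ ∀ i < n, ¬ A.Event (K + i) := by
  classical
  have hex : ∃ n, A.Event (K + n) := by
    obtain ⟨k, hk, hE⟩ := A.exists_event hd hd2 hs K
    exact ⟨k - K, by rwa [Nat.add_sub_cancel' hk]⟩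
  exact ⟨Nat.find hex, Nat.find_spec hex, fun i hi => Nat.find_min hex hi⟩

theorem exists_event_phase (A : StageSeq d) (hd : ∀ k, 0 < d k) (hd2 : ∀ k, d k ≤ 1 / 2)
    (hs : ¬ Summable d) (K : ℕ) : ∃ k, K ≤ k ∧ A.Event k ∧ (A.S k).phase = (A.S K).phase ∧
      ∀ {ρ : ℕ → ℝ} {t : ℝ} {T N : ℕ}, A.IsNegOrbit ρ → A.Reference ρ t K T N →
        ∃ T' N', A.Reference ρ t k T' N' ∧ N' + T = N + T' := by
  obtain ⟨n, hE, hn⟩ := A.exists_first_event hd hd2 hs K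
  refine ⟨K + n, by omega, hE, ?_, ?_⟩
  · have key : ∀ i ≤ n, (A.S (K + i)).phase = (A.S K).phase := by
      intro i
      induction i with
      | zero => simp
      | succ i ih =>
        intro hi
        rw [← ih (by omega)]
        exact ((A.spec.step (K + i)).not_overtakes (hn i (by omega))).2
    exact key n le_rfl
  · intro ρ t T N hρ h
    have key : ∀ i ≤ n, ∃ T' N', A.Reference ρ t (K + i) T' N' ∧ N' + T = N + T' := by
      intro i
      induction i with
      | zero => exact fun _ => ⟨T, N, h, rfl⟩
      | succ i ih =>
        intro hi
        obtain ⟨T', N', h1, h2⟩ := ih (by omega)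
        exact ⟨_, _, h1.step hd hd2 hρ (hn i (by omega)), by omega⟩
    exact key n le_rfl

/-- At an event the zero is compared with the reference orbit one step earlier, so the lag increases
by one. -/
theorem Reference.event {A : StageSeq d} {ρ : ℕ → ℝ} {t : ℝ} {k T N : ℕ}
    (h : A.Reference ρ t k T N) (hd : ∀ k, 0 < d k) (hd2 : ∀ k, d k ≤ 1 / 2)
    (hρ : A.IsNegOrbit ρ) (hk : A.Event k) (hph : (A.S k).phase ≠ 2) :
    ∃ T' N', A.Reference ρ t (k + 1) T' N' ∧ N' + T + 1 = N + T' := by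
  have hm := (A.spec.step k).one_le
  refine ⟨T + 1 + A.m k, N + A.m k, ⟨A.advance_upper hd hd2 hρ h.1, ?_⟩, by omega⟩
  rw [((A.spec.step k).overtakes_of_ne hk hph).1]
  have := A.advance_lower hd hd2 h.2 (A.m k - 1)
  rwa [show N + 1 + (A.m k - 1) = N + A.m k by omega] at this

/-- An event can instead turn the comparison through W into a direct one between the two orbits,
without change of lag. -/
theorem Reference.gain {A : StageSeq d} {ρ : ℕ → ℝ} {t : ℝ} {k T N : ℕ}
    (h : A.Reference ρ t k T N) (hd : ∀ k, 0 < d k) (hd2 : ∀ k, d k ≤ 1 / 2)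
    (hρ : A.IsNegOrbit ρ) (hk : A.Event k) :
    ∃ T' N', ρ T' ≤ Real.exp (A.psi^[N'] t) ∧ N' + T = N + T' := by
  refine ⟨T + 1 + A.m k, N + 1 + A.m k, (A.advance_upper hd hd2 hρ h.1).trans ?_, by omega⟩
  rw [Real.exp_le_exp]
  have h1 := A.advance_lower hd hd2 h.2 (A.m k)
  have h2 : 2 * A.X (k + 1) ≤ _ := hk
  have := (A.wellSeparated hd hd2).pos (k + 1)
  linarith

/-- Events recur, and every third one resets W to the zero itself, a reference point that does not
depend on the orbit to be compared. -/
theorem exists_restart (A : StageSeq d) (hd : ∀ k, 0 < d k) (hd2 : ∀ k, d k ≤ 1 / 2)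
    (hs : ¬ Summable d) (K : ℕ) : ∃ k, K ≤ k ∧ (A.S k).phase = 0 ∧ (A.S k).W = A.X k := by
  have hle : ∀ k, (A.S k).phase ≤ 2 := by
    intro k
    induction k with
    | zero => rw [A.spec.phase_zero]; omega
    | succ k ih =>
      by_cases hE : A.Event k
      · by_cases hph : (A.S k).phase = 2
        · rw [((A.spec.step k).overtakes_of_eq hE hph).2]; omega
        · rw [((A.spec.step k).overtakes_of_ne hE hph).2]; omega
      · rwa [((A.spec.step k).not_overtakes hE).2]
  have key : ∀ n K, (A.S K).phase + n = 2 →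
      ∃ k, K ≤ k ∧ (A.S k).phase = 0 ∧ (A.S k).W = A.X k := by
    intro n
    induction n with
    | zero =>
      intro K hK
      obtain ⟨k, hk, hE, hph, -⟩ := A.exists_event_phase hd hd2 hs K
      have h1 := (A.spec.step k).overtakes_of_eq hE (by omega)
      exact ⟨k + 1, by omega, h1.2, h1.1⟩
    | succ n ih =>
      intro K hK
      obtain ⟨k, hk, hE, hph, -⟩ := A.exists_event_phase hd hd2 hs K
      have h1 := (A.spec.step k).overtakes_of_ne hE (by omega)
      obtain ⟨k', hk', h2⟩ := ih (k + 1) (by omega)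
      exact ⟨k', by omega, h2⟩
  exact key (2 - (A.S K).phase) K (by have := hle K; omega)

/-- Three successive events: two increase the lag, and the third converts back to a direct
comparison. -/
theorem Reference.round {A : StageSeq d} {ρ : ℕ → ℝ} {t : ℝ} {k T N : ℕ}
    (h : A.Reference ρ t k T N) (hd : ∀ k, 0 < d k) (hd2 : ∀ k, d k ≤ 1 / 2)
    (hs : ¬ Summable d) (hρ : A.IsNegOrbit ρ) (hk : (A.S k).phase = 0) :
    ∃ T' N', ρ T' ≤ Real.exp (A.psi^[N'] t) ∧ N' + T + 2 = N + T' := by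
  obtain ⟨k1, -, hE1, hph1, hrun1⟩ := A.exists_event_phase hd hd2 hs k
  obtain ⟨T1, N1, h1, e1⟩ := hrun1 hρ h
  obtain ⟨T2, N2, h2, e2⟩ := h1.event hd hd2 hρ hE1 (by omega)
  have hph2 := ((A.spec.step k1).overtakes_of_ne hE1 (by omega)).2
  obtain ⟨k3, -, hE3, hph3, hrun3⟩ := A.exists_event_phase hd hd2 hs (k1 + 1)
  obtain ⟨T3, N3, h3, e3⟩ := hrun3 hρ h2
  obtain ⟨T4, N4, h4, e4⟩ := h3.event hd hd2 hρ hE3 (by omega)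
  obtain ⟨k5, -, hE5, -, hrun5⟩ := A.exists_event_phase hd hd2 hs (k3 + 1)
  obtain ⟨T5, N5, h5, e5⟩ := hrun5 hρ h4
  obtain ⟨T6, N6, h6, e6⟩ := h5.gain hd hd2 hρ hE5
  exact ⟨T6, N6, h6, by omega⟩

theorem IsNegOrbit.exists_gain {A : StageSeq d} {ρ : ℕ → ℝ} (hρ : A.IsNegOrbit ρ)
    (hd : ∀ k, 0 < d k) (hd2 : ∀ k, d k ≤ 1 / 2) (hs : ¬ Summable d) {t : ℝ} (ht : 0 < t)
    {T N : ℕ} (h : ρ T ≤ Real.exp (A.psi^[N] t)) :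
    ∃ T' N', ρ T' ≤ Real.exp (A.psi^[N'] t) ∧ N' + T + 1 = N + T' := by
  have hX := A.wellSeparated hd hd2
  obtain ⟨K, hK⟩ := exists_nat_ge (A.psi^[N] t)
  obtain ⟨k, hKk, hph, hW⟩ := A.exists_restart hd hd2 hs K
  have hle : A.psi^[N] t ≤ A.X k := by
    have h1 := hX.lower k
    have h2 : (K : ℝ) ≤ k := by exact_mod_cast hKk
    have h3 : (0 : ℝ) ≤ k := k.cast_nonneg
    linarith
  obtain ⟨n, hn, hn1, hn2⟩ := hX.exists_iterate_le_lt ht (B := N) hle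
  have hgrow : ∀ i, ρ (T + i) ≤ Real.exp (A.psi^[N + i] t) := by
    intro i
    induction i with
    | zero => exact h
    | succ i ih =>
      have := hρ.growth _ _ ih
      rwa [← Function.iterate_succ_apply' A.psi] at this
  -- The reference orbit must lie above W = X_k, hence `n + 1`: entering costs one step, and the two
  -- steps won in a round leave a net gain of one.
  have hR : A.Reference ρ t k (T + (n - N)) (n + 1) := by
    refine ⟨(hgrow _).trans ?_, ?_⟩
    · rw [Nat.add_sub_cancel' hn]
      exact Real.exp_le_exp.2 hn1
    · rw [hW]
      exact hn2.le
  obtain ⟨T', N', h1, h2⟩ := hR.round hd hd2 hs hρ hph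
  exact ⟨T', N', h1, by omega⟩

theorem IsNegOrbit.exists_lag {A : StageSeq d} {ρ : ℕ → ℝ} (hρ : A.IsNegOrbit ρ)
    (hd : ∀ k, 0 < d k) (hd2 : ∀ k, d k ≤ 1 / 2) (hs : ¬ Summable d) {t : ℝ} (ht : 0 < t)
    (L : ℕ) : ∃ n, ρ (n + L) ≤ Real.exp (A.psi^[n] t) := by
  have hX := A.wellSeparated hd hd2
  obtain ⟨B, hB⟩ : ∃ B, ρ 0 ≤ Real.exp (A.psi^[B] t) :=
    ((Real.tendsto_exp_atTop.comp (hX.tendsto_iterate ht)).eventually_ge_atTop (ρ 0)).exists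
  have key : ∀ l, ∃ T N, ρ T ≤ Real.exp (A.psi^[N] t) ∧ N + l = B + T := by
    intro l
    induction l with
    | zero => exact ⟨0, B, hB, rfl⟩
    | succ l ih =>
      obtain ⟨T, N, h1, h2⟩ := ih
      obtain ⟨T', N', h3, h4⟩ := hρ.exists_gain hd hd2 hs ht h1
      exact ⟨T', N', h3, by omega⟩
  -- The extra `B` gains pay for the initial shift.
  obtain ⟨T, N, h1, h2⟩ := key (B + L)
  exact ⟨N, by rwa [show N + L = T by omega]⟩

theorem isNegOrbit (A : StageSeq d) (hd : ∀ k, 0 < d k) (hd2 : ∀ k, d k ≤ 1 / 2) {x : ℝ}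
    (hx : x ≤ 0) : A.IsNegOrbit fun n => ‖A.func^[n] (x : ℂ)‖ := by
  have hX := A.wellSeparated hd hd2
  have hreal : ∀ n, ∃ y : ℝ, 0 ≤ y ∧ A.func^[n] (x : ℂ) = ((-y : ℝ) : ℂ) := by
    intro n
    induction n with
    | zero => exact ⟨-x, by linarith, by simp⟩
    | succ n ih =>
      obtain ⟨y, hy, he⟩ := ih
      rw [Function.iterate_succ_apply', he]
      exact canonicalProd_neg_real (fun n => Real.exp_pos (A.X n)) hX.summable_div hy
  constructor
  · intro n k h
    obtain ⟨y, hy, he⟩ := hreal n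
    simp only [Function.iterate_succ_apply', he] at h ⊢
    refine A.norm_func_neg_le hd hd2 hy ?_
    simpa [abs_of_nonneg hy] using h
  · intro n t h
    simp only [Function.iterate_succ_apply']
    exact hX.norm_le_exp_logGrowth h

theorem fastEscapingSet_inter (A : StageSeq d) (hd : ∀ k, 0 < d k) (hd2 : ∀ k, d k ≤ 1 / 2)
    (hs : ¬ Summable d) {R : ℝ} (hR : IsAdmissible A.func R) :
    fastEscapingSet A.func R ∩ ((fun x : ℝ => (x : ℂ)) '' Set.Iic 0) = ∅ := by
  have hX := A.wellSeparated hd hd2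
  rw [Set.eq_empty_iff_forall_notMem]
  rintro _ ⟨hz, x, hx, rfl⟩
  obtain ⟨l, hl⟩ := Set.mem_iUnion.1 hz
  have hR0 := hR.1
  set s := Real.log R with hs_def
  have hRs : R = Real.exp s := (Real.exp_log hR0).symm
  have hlt : s < A.psi s := by
    have := hR.2 R le_rfl
    rwa [hRs, func, hX.exp_logGrowth, Real.exp_lt_exp] at this
  -- The orbit of R eventually passes ψ(1). A lag of `j + l` behind the orbit of 1 then puts the
  -- negative orbit strictly below M^(n+j)(R).
  obtain ⟨j, hj⟩ : ∃ j, A.psi 1 ≤ A.psi^[j] s := by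
    obtain ⟨j, hj⟩ := exists_nat_ge ((A.psi 1 - s) / (A.psi s - s))
    refine ⟨j, le_trans ?_ (hX.add_le_iterate (η := A.psi s - s) (by linarith)
      (by simp [psi]) j)⟩
    rw [div_le_iff₀ (by linarith)] at hj
    linarith
  obtain ⟨n, hn⟩ := (A.isNegOrbit hd hd2 hx).exists_lag hd hd2 hs one_pos (j + l)
  have h1 := hl (n + j)
  rw [hRs, func, hX.maxModulusIter_exp, ← Function.iterate_add_apply] at h1
  have h2 : A.psi^[n + 1] 1 ≤ A.psi^[n + j] s := by
    rw [Function.iterate_add_apply, Function.iterate_add_apply]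
    exact hX.logGrowth_mono.iterate n (by simpa using hj)
  have h3 := hX.strictMono_iterate one_pos (Nat.lt_succ_self n)
  simp only [← add_assoc] at hn
  have h4 := Real.exp_le_exp.1 (h1.trans hn)
  simp only [psi] at h2 h4
  simp only [Nat.succ_eq_add_one] at h3
  linarith

end StageSeq

/-! ### Exclusion of spider's webs -/

/-- The half-line is connected, meets the bounded domain containing 0 and leaves it, so it meets the
boundary of that domain. -/
theorem not_isSpidersWeb_of_inter_eq_empty {E : Set ℂ}
    (h : E ∩ ((fun x : ℝ => (x : ℂ)) '' Set.Iic 0) = ∅) : ¬ IsSpidersWeb E := by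
  rintro ⟨-, G, hG, hfr, -, hU⟩
  have h0 : (0 : ℂ) ∈ ⋃ n, G n := hU ▸ Set.mem_univ _
  obtain ⟨n, hn⟩ := Set.mem_iUnion.1 h0
  obtain ⟨hopen, -, hbdd⟩ := hG n
  set I := (fun x : ℝ => (x : ℂ)) '' Set.Iic 0 with hI
  have hIc : IsPreconnected I := isPreconnected_Iic.image _ Complex.continuous_ofReal.continuousOn
  obtain ⟨r, hr⟩ := hbdd.subset_closedBall 0
  have hout : ((-(|r| + 1) : ℝ) : ℂ) ∉ G n := by
    intro hmem
    have := hr hmem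
    rw [mem_closedBall_zero_iff, Complex.norm_real, Real.norm_eq_abs, abs_neg,
      abs_of_nonneg (by positivity)] at this
    linarith [le_abs_self r]
  have hsub : I ⊆ G n ∪ (closure (G n))ᶜ := by
    intro z hz
    by_contra hcon
    rw [Set.mem_union, Set.mem_compl_iff, not_or, not_not] at hcon
    have : z ∈ frontier (G n) := by
      rw [hopen.frontier_eq]
      exact ⟨hcon.2, hcon.1⟩
    exact (h ▸ (⟨hfr n this, hz⟩ : z ∈ E ∩ I) : z ∈ (∅ : Set ℂ))
  have hmem : ((-(|r| + 1) : ℝ) : ℂ) ∈ I := ⟨_, Set.mem_Iic.2 (by linarith [abs_nonneg r]), rfl⟩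
  obtain ⟨w, -, hw1, hw2⟩ := hIc _ _ hopen isClosed_closure.isOpen_compl hsub
    ⟨0, ⟨0, by simp, by simp⟩, hn⟩ ⟨_, hmem, (hsub hmem).resolve_left hout⟩
  exact hw2 (subset_closure hw1)

/-! ### Growth exponents -/

/-- Source of the error 1/2^n: R_n ≥ exp(3^n · 10), and (3/2)^n ≥ 1 + n/2 outweighs the logarithm of
3^n. -/
theorem log_six_mul_le {t : ℝ} {n : ℕ} (h : 3 ^ n * 10 ≤ t) : Real.log (6 * t) ≤ t / 2 ^ n := by
  obtain ⟨s, hs, rfl⟩ : ∃ s, 10 ≤ s ∧ t = 3 ^ n * s :=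
    ⟨t / 3 ^ n, by rwa [le_div_iff₀' (by positivity)], by field_simp⟩
  have hs0 : 0 < s := by linarith
  have h6 := Real.log_le_sub_one_of_pos (show (0 : ℝ) < 6 by norm_num)
  have h3 := Real.log_le_sub_one_of_pos (show (0 : ℝ) < 3 by norm_num)
  have h2 := Real.log_le_sub_one_of_pos (show (0 : ℝ) < 2 by norm_num)
  have hl := Real.log_le_sub_one_of_pos (show 0 < s / 2 by positivity)
  rw [Real.log_div hs0.ne' two_ne_zero] at hl
  rw [Real.log_mul (by norm_num) (by positivity), Real.log_mul (by positivity) hs0.ne', Real.log_pow]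
  have hb := one_add_mul_le_pow (show (-2 : ℝ) ≤ 1 / 2 by norm_num) n
  have he : 3 ^ n * s / 2 ^ n = (1 + 1 / 2) ^ n * s := by
    rw [mul_div_right_comm, ← div_pow]
    norm_num
  rw [he]
  have hn : (0 : ℝ) ≤ n := n.cast_nonneg
  have h4 : (1 + n * (1 / 2)) * s ≤ (1 + 1 / 2) ^ n * s := by gcongr
  have h5 : (n : ℝ) * Real.log 3 ≤ n * 2 := by gcongr; linarith
  have h7 : (n : ℝ) * 10 ≤ n * s := by gcongr
  linarith

/-- A summable truncation tends to 0, so it agrees with `δ` at all but finitely many indices. -/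
theorem not_summable_min {δ : ℕ → ℝ} (hδ : ¬ Summable δ) :
    ¬ Summable fun n => min (δ n) (1 / 2) := by
  intro h
  apply hδ
  have h1 : ∀ᶠ n in cofinite, min (δ n) (1 / 2) < 1 / 2 :=
    h.tendsto_cofinite_zero.eventually (gt_mem_nhds (by norm_num))
  refine (summable_congr_cofinite ?_).1 h
  filter_upwards [h1] with n hn
  exact min_eq_left ((min_lt_iff.1 hn).resolve_right (lt_irrefl _)).le

namespace StageSeq

variable {d : ℕ → ℝ}

theorem isExample (A : StageSeq d) (hd : ∀ k, 0 < d k) (hd2 : ∀ k, d k ≤ 1 / 2)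
    (hs : ¬ Summable d) : IsExample A.func (fun n => Real.exp (A.X n)) A.p := by
  have hX := A.wellSeparated hd hd2
  have h0 : ∀ n, 0 < Real.exp (A.X n) := fun n => Real.exp_pos _
  have hm : StrictMono fun n => Real.exp (A.X n) := Real.exp_strictMono.comp hX.strictMono
  refine ⟨isTranscendentalEntire_canonicalProd h0 hm hX.summable_div hX.mult_pos, h0, hm,
    hX.mult_pos, fun z => ⟨multipliable_factors h0 hX.summable_div z, rfl⟩, fun R hR => ?_⟩
  have := A.fastEscapingSet_inter hd hd2 hs hR
  exact ⟨this, not_isSpidersWeb_of_inter_eq_empty this⟩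

theorem isAdmissible (A : StageSeq d) (hd : ∀ k, 0 < d k) (hd2 : ∀ k, d k ≤ 1 / 2) :
    IsAdmissible A.func (Real.exp 10) := by
  have hX := A.wellSeparated hd hd2
  refine ⟨Real.exp_pos _, fun r hr => ?_⟩
  have hr0 : 0 < r := (Real.exp_pos _).trans_le hr
  have ht : 10 ≤ Real.log r := (Real.le_log_iff_exp_le hr0).2 hr
  rw [← Real.exp_log hr0, func, hX.exp_logGrowth, Real.exp_lt_exp]
  linarith [hX.three_mul_le_logGrowth (Real.log r)]

theorem exists_isGrowthExponent (A : StageSeq d) (hd : ∀ k, 0 < d k) (hd2 : ∀ k, d k ≤ 1 / 2)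
    (n : ℕ) : ∃ ε, IsGrowthExponent A.func (Real.exp 10) n ε := by
  have hX := A.wellSeparated hd hd2
  have hy := hX.iterate_lt_succ (show (0 : ℝ) < 10 by norm_num) n
  have hrange : ∀ r ∈ Set.Icc (maxModulusIter A.func (Real.exp 10) n)
      (maxModulusIter A.func (Real.exp 10) (n + 1)), 1 < r := by
    intro r hr
    rw [func, hX.maxModulusIter_exp] at hr
    exact (Real.one_lt_exp_iff.2 hy.1).trans_le hr.1
  have hlog : ∀ r, 1 < r → 0 < Real.log (maxModulus A.func r) := by
    intro r hr
    have h1 := Real.log_pos hr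
    rw [← Real.exp_log (show 0 < r by linarith), func, hX.exp_logGrowth, Real.log_exp]
    linarith [hX.three_mul_le_logGrowth (Real.log r)]
  have hM : ContinuousOn (maxModulus A.func) (Set.Ici 0) := by
    have hf : Continuous A.func :=
      (differentiable_canonicalProd (fun n => Real.exp_pos (A.X n)) hX.summable_div).continuous
    refine (hf.comp Complex.continuous_ofReal).norm.continuousOn.congr fun r hr => ?_
    rw [func, maxModulus_canonicalProd (fun n => Real.exp_pos (A.X n)) hX.summable_div hr]
    exact (norm_canonicalProd_ofReal (fun n => Real.exp_pos (A.X n)) hX.summable_div hr).symm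
  refine (isCompact_Icc.image_of_continuousOn ?_).exists_isGreatest (Set.Nonempty.image _ ?_)
  · refine ContinuousOn.div (ContinuousOn.log (ContinuousOn.log (hM.mono ?_) ?_) ?_)
      (Real.continuousOn_log.mono ?_) ?_
    · exact fun r hr => (one_pos.trans (hrange r hr)).le
    · intro r hr h0
      have := hlog r (hrange r hr)
      rw [h0, Real.log_zero] at this
      exact lt_irrefl _ this
    · exact fun r hr => (hlog r (hrange r hr)).ne'
    · exact fun r hr => (one_pos.trans (hrange r hr)).ne'
    · exact fun r hr => (Real.log_pos (hrange r hr)).ne'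
  · rw [Set.nonempty_Icc, func, hX.maxModulusIter_exp, hX.maxModulusIter_exp, Real.exp_le_exp]
    linarith

theorem growthExponent_le (A : StageSeq d) (hd : ∀ k, 0 < d k) (hd2 : ∀ k, d k ≤ 1 / 2)
    {n : ℕ} {ε B : ℝ} (hε : IsGrowthExponent A.func (Real.exp 10) n ε)
    (h : ∀ t, A.psi^[n] 10 ≤ t → t ≤ A.psi^[n + 1] 10 →
      Real.log (A.psi t) ≤ B * t + Real.log (6 * t)) : ε ≤ B + 1 / 2 ^ n := by
  have hX := A.wellSeparated hd hd2
  obtain ⟨⟨r, hr, rfl⟩, -⟩ := hε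
  rw [func, hX.maxModulusIter_exp, hX.maxModulusIter_exp] at hr
  have hr0 : 0 < r := (Real.exp_pos _).trans_le hr.1
  obtain ⟨t, rfl⟩ : ∃ t, r = Real.exp t := ⟨_, (Real.exp_log hr0).symm⟩
  have h1 : A.psi^[n] 10 ≤ t := Real.exp_le_exp.1 hr.1
  have h2 : t ≤ A.psi^[n + 1] 10 := Real.exp_le_exp.1 hr.2
  have h3 : 3 ^ n * 10 ≤ t := by
    have := hX.pow_mul_le_iterate (show (0 : ℝ) < 10 by norm_num) 0 n
    rw [Function.iterate_zero, id, zero_add] at this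
    exact this.trans h1
  have ht : 0 < t := lt_of_lt_of_le (by positivity) h3
  simp only
  rw [func, hX.exp_logGrowth, Real.log_exp, Real.log_exp, div_le_iff₀ ht]
  have h4 := h t h1 h2
  have h5 := log_six_mul_le h3
  rw [psi] at h4
  calc _ ≤ B * t + Real.log (6 * t) := h4
    _ ≤ B * t + t / 2 ^ n := by linarith
    _ = _ := by ring

theorem log_psi_le (A : StageSeq d) (hd : ∀ k, 0 < d k) (hd2 : ∀ k, d k ≤ 1 / 2) {k : ℕ} {t : ℝ}
    (h1 : 1 ≤ t) (h2 : t ≤ A.X (k + 1) / 2) :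
    Real.log (A.psi t) ≤ d k * A.X k / 4 + Real.log (6 * t) := by
  have hX := A.wellSeparated hd hd2
  have h3 := hX.logGrowth_le_linear h1 h2
  have h4 := (A.spec.inv k).exp_ge (hd (k + 1))
  have h5 : ((A.S k).mult (d k) : ℝ) ≤ Real.exp (d k * (A.S k).X / 4) / 4 :=
    Stage.Invariant.mult_le
  rw [← A.D_eq, (A.spec.step k).D_eq, Stage.nextD] at h3
  set E := Real.exp (d k * A.X k / 4) with hE
  have hE0 : 0 < E := Real.exp_pos _
  change _ ≤ E / 4 at h5
  change _ ≤ d (k + 1) * E at h4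
  have h6 : d (k + 1) * E ≤ 1 / 2 * E := by gcongr; exact hd2 _
  have h7 := (A.spec.inv k).three_le
  have h8 : ((A.S k).D + 2 * (A.S k).mult (d k)) * t ≤ (2 * E) * t := by
    gcongr
    linarith
  have h9 : (1 : ℝ) ≤ E := by linarith
  have h10 : 1 ≤ E * t := by nlinarith
  have hpos : 0 < A.psi t := by
    have := hX.three_mul_le_logGrowth t
    rw [psi]
    linarith
  calc Real.log (A.psi t) ≤ Real.log (E * (6 * t)) := by
        apply Real.log_le_log hpos
        rw [psi]
        linarith
    _ = _ := by rw [Real.log_mul hE0.ne' (by positivity), hE, Real.log_exp]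

theorem psi_le (A : StageSeq d) (hd : ∀ k, 0 < d k) (hd2 : ∀ k, d k ≤ 1 / 2) {k : ℕ} {t : ℝ}
    (h1 : 1 ≤ t) (h2 : t ≤ A.X k / 2) : A.psi t ≤ 2 * (A.S k).D * t := by
  have h3 := (A.wellSeparated hd hd2).logGrowth_le_linear h1 h2
  have h4 := (A.spec.inv k).three_le
  rw [← A.D_eq] at h3
  rw [psi]
  nlinarith

theorem exists_growthExponents (A : StageSeq d) (hd : ∀ k, 0 < d k) (hd2 : ∀ k, d k ≤ 1 / 2) :
    ∃ ε : ℕ → ℝ, (∀ n, IsGrowthExponent A.func (Real.exp 10) n (ε n)) ∧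
      ∃ N : ℕ → ℕ, StrictMono N ∧ (∀ k, 1 ≤ N k) ∧
        (∀ k, ε (N k) ≤ d k + 1 / 2 ^ N k) ∧
        (∀ k m, 1 ≤ m → N k + m < N (k + 1) →
          ε (N k + m) ≤ d k / 3 ^ (m - 1) + 1 / 2 ^ (N k + m)) := by
  have hX := A.wellSeparated hd hd2
  have h10 : (0 : ℝ) < 10 := by norm_num
  have hymono : StrictMono fun n => A.psi^[n] 10 := hX.strictMono_iterate h10
  have hy10 : ∀ n, 10 ≤ A.psi^[n] 10 := fun n => by simpa using hymono.monotone (Nat.zero_le n)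
  have hsucc : ∀ n, A.psi^[n + 1] 10 = A.psi (A.psi^[n] 10) :=
    fun n => Function.iterate_succ_apply' _ _ _
  choose ε hε using A.exists_isGrowthExponent hd hd2
  have hX0 : 360000 ≤ A.X 0 := by
    have := ((A.spec.inv 0).X_ge (hd 0) (hd2 0) (hd2 _)).1
    have := (A.spec.inv 0).three_le
    change _ ≤ (A.S 0).X
    linarith
  have hXmono := hX.strictMono.monotone
  have hfirst : ∀ k, A.psi^[1] 10 ≤ A.X k / 2 := by
    intro k
    have h0 : A.X 0 ≤ A.X k := hXmono (Nat.zero_le k)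
    have := A.psi_le hd hd2 (k := 0) (t := 10) (by norm_num) (by linarith)
    rw [A.spec.D_zero] at this
    rw [Function.iterate_one]
    linarith
  -- `N k` is the last time at which the orbit of R is at most exp(X_k/2), the square root of the
  -- zero's modulus; `hfirst` makes it at least 1.
  choose N hN1 hNle hNlt using fun k => hX.exists_iterate_le_lt h10 (hfirst k)
  have hNle : ∀ k, A.psi^[N k] 10 ≤ A.X k / 2 := hNle
  have hNlt : ∀ k, A.X k / 2 < A.psi^[N k + 1] 10 := hNlt
  -- One step multiplies t by at most 2D here, and X_{k+1} is far larger than D X_k. Thus the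
  -- interval from R_{N k} to R_{N k + 1} ends before the next zero matters.
  have hnext : ∀ k, A.psi^[N k + 1] 10 ≤ A.X (k + 1) / 2 := by
    intro k
    have h1 := hX.ratio k
    have h2 := hX.pos k
    have h3 := A.psi_le hd hd2 (k := k + 1) (t := A.psi^[N k] 10) (by linarith [hy10 (N k)])
      (by linarith [hNle k])
    have h4 := ((A.spec.inv (k + 1)).X_ge (hd _) (hd2 _) (hd2 _)).2
    rw [(A.spec.step k).prev_eq] at h4
    change 120000 * ((A.S (k + 1)).D * A.X k) ≤ A.X (k + 1) at h4
    have h5 := (A.spec.inv (k + 1)).three_le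
    have h6 : 2 * (A.S (k + 1)).D * A.psi^[N k] 10 ≤ 2 * (A.S (k + 1)).D * (A.X k / 2) := by
      gcongr
      exact hNle k
    rw [hsucc]
    have : 0 ≤ (A.S (k + 1)).D * A.X k := by positivity
    linarith
  have hNmono : StrictMono N := strictMono_nat_of_lt_succ fun k => by
    have := hymono.lt_iff_lt.1 ((hnext k).trans_lt (hNlt (k + 1)))
    omega
  refine ⟨ε, hε, N, hNmono, hN1, fun k => ?_, fun k m hm hlt => ?_⟩
  · refine A.growthExponent_le hd hd2 (hε _) fun t ht1 ht2 => ?_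
    have ht10 := (hy10 _).trans ht1
    have hdt : 0 ≤ d k * t := mul_nonneg (hd k).le (by linarith)
    -- Beyond X_k/2 the term d_k X_k/4 is at most d_k t/2. Below, only the previous zero counts; its
    -- term is small since ψ(R-orbit) > X_k/2 forces t > X_k/(4D), hence d_k t ≥ X_{k-1}.
    rcases le_total (A.X k / 2) t with hc | hc
    · have h1 := A.log_psi_le hd hd2 (k := k) (t := t) (by linarith) (ht2.trans (hnext k))
      have h2 := mul_le_mul_of_nonneg_left hc (hd k).le
      linarith
    · cases k with
      | zero =>
        have h1 := A.psi_le hd hd2 (k := 0) (t := t) (by linarith) hc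
        rw [A.spec.D_zero] at h1
        have hpos : 0 < A.psi t := by
          have := hX.three_mul_le_logGrowth t
          rw [psi]
          linarith
        have := Real.log_le_log hpos h1
        norm_num at this
        linarith
      | succ j =>
        have h1 := A.log_psi_le hd hd2 (k := j) (t := t) (by linarith) hc
        have h2 := A.psi_le hd hd2 (k := j + 1) (t := A.psi^[N (j + 1)] 10)
          (by linarith [hy10 (N (j + 1))]) (hNle (j + 1))
        have h3 := (A.spec.inv (j + 1)).dX_large (hd _) (hd2 _)
        rw [(A.spec.step j).prev_eq] at h3
        change _ * (A.X j + 1) ≤ _ * A.X (j + 1) at h3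
        have h4 := (A.spec.inv (j + 1)).three_le
        have h5 := hNlt (j + 1)
        rw [hsucc] at h5
        have h6 : d (j + 1) * A.X (j + 1) ≤ d (j + 1) * (4 * (A.S (j + 1)).D * t) := by
          have := hd (j + 1)
          have h7 : 2 * (A.S (j + 1)).D * A.psi^[N (j + 1)] 10 ≤ 2 * (A.S (j + 1)).D * t := by
            gcongr
          gcongr
          linarith
        have h8 : A.X j ≤ d (j + 1) * t := by
          have h9 : (A.S (j + 1)).D * A.X j ≤ (A.S (j + 1)).D * (d (j + 1) * t) := by
            have : 0 ≤ (A.S (j + 1)).D * A.X j := by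
              have := hX.pos j
              positivity
            linarith
          exact le_of_mul_le_mul_left h9 (by linarith)
        have h10 : d j * A.X j ≤ 1 / 2 * A.X j := by
          have := hX.pos j
          gcongr
          exact hd2 j
        have := hX.pos j
        linarith
  · refine A.growthExponent_le hd hd2 (hε _) fun t ht1 ht2 => ?_
    have ht10 := (hy10 _).trans ht1
    have hle : t ≤ A.X (k + 1) / 2 :=
      ht2.trans ((hymono.monotone (show N k + m + 1 ≤ N (k + 1) by omega)).trans (hNle (k + 1)))
    have h1 := A.log_psi_le hd hd2 (k := k) (t := t) (by linarith) hle
    have h2 := hX.pow_mul_le_iterate h10 (N k + 1) (m - 1)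
    rw [show N k + 1 + (m - 1) = N k + m by omega] at h2
    -- The tripling starts at time N k + 1, the first one beyond X_k/2; hence the exponent m - 1.
    have h3 : 3 ^ (m - 1) * (A.X k / 2) ≤ t := by
      refine le_trans ?_ (h2.trans ht1)
      have := hNlt k
      gcongr
      exact this.le
    have h4 : d k * A.X k / 4 ≤ d k / 3 ^ (m - 1) * t := by
      have h5 : 0 < d k / 3 ^ (m - 1) := div_pos (hd k) (by positivity)
      have h6 := mul_le_mul_of_nonneg_left h3 h5.le
      have h7 : d k / 3 ^ (m - 1) * (3 ^ (m - 1) * (A.X k / 2)) = d k * A.X k / 2 := by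
        field_simp
      have := mul_pos (hd k) (hX.pos k)
      linarith
    linarith

end StageSeq

end FastEscaping

/-- Examples of entire functions whose fast escaping set misses the negative real axis, with
control of the growth exponents. Sequences `a, p, δ, N` are indexed from `0` (their first term has
index `0`), while `n ↦ R_n = M^n(R)` starts with `R_0 = R`. -/
theorem theorem2 :
    (∃ (f : ℂ → ℂ) (a : ℕ → ℝ) (p : ℕ → ℕ), FastEscaping.IsExample f a p) ∧
    (∀ δ : ℕ → ℝ, (∀ n, 0 < δ n) → ¬ Summable δ →
      ∃ (f : ℂ → ℂ) (a : ℕ → ℝ) (p : ℕ → ℕ) (R : ℝ),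
        (∀ n, p n = ⌊a n ^ (min (δ n) (1 / 2) / 4) / 4⌋₊) ∧
        FastEscaping.IsExample f a p ∧
        1 < R ∧ FastEscaping.IsAdmissible f R ∧
        ∃ ε : ℕ → ℝ, (∀ n, FastEscaping.IsGrowthExponent f R n (ε n)) ∧
          ∃ N : ℕ → ℕ, StrictMono N ∧ (∀ k, 1 ≤ N k) ∧
            (∀ k, ε (N k) ≤ min (δ k) (1 / 2) + 1 / 2 ^ N k) ∧
            (∀ k m, 1 ≤ m → N k + m < N (k + 1) →
              ε (N k + m) ≤ min (δ k) (1 / 2) / 3 ^ (m - 1) + 1 / 2 ^ (N k + m))) := by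
  have key : ∀ δ : ℕ → ℝ, (∀ n, 0 < δ n) → ¬ Summable δ →
      ∃ A : FastEscaping.StageSeq fun n => min (δ n) (1 / 2),
        (∀ n, (0 : ℝ) < min (δ n) (1 / 2)) ∧ (∀ n, min (δ n) (1 / 2) ≤ (1 / 2 : ℝ)) ∧
          FastEscaping.IsExample A.func (fun n => Real.exp (A.X n)) A.p := by
    intro δ hδ hs
    have hd : ∀ n, (0 : ℝ) < min (δ n) (1 / 2) := fun n => lt_min (hδ n) (by norm_num)
    have hd2 : ∀ n, min (δ n) (1 / 2) ≤ (1 / 2 : ℝ) := fun n => min_le_right _ _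
    obtain ⟨A⟩ := FastEscaping.StageSeq.nonempty hd hd2
    exact ⟨A, hd, hd2, A.isExample hd hd2 (FastEscaping.not_summable_min hs)⟩
  constructor
  · obtain ⟨A, -, -, hA⟩ := key (fun _ => 1) (fun _ => one_pos) (by simp [summable_const_iff])
    exact ⟨_, _, _, hA⟩
  · intro δ hδ hs
    obtain ⟨A, hd, hd2, hA⟩ := key δ hδ hs
    refine ⟨A.func, _, A.p, Real.exp 10, fun n => ?_, hA, Real.one_lt_exp_iff.2 (by norm_num),
      A.isAdmissible hd hd2, A.exists_growthExponents hd hd2⟩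
    rw [← Real.exp_mul, FastEscaping.StageSeq.p, FastEscaping.multiplicity]
    congr 3
    ring
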